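/- Let $\boldsymbol n=(n_1,n_2)$ and $\boldsymbol m=(m_1,m_2)$ be pairs of nonnegative integers with $n_1+n_2=m_1+m_2$. For $\boldsymbol\mu,\boldsymbol w\in\mathbb C^2$, $\boldsymbol k=(k_1,k_2)\in\mathbb Z_{\ge0}^2$ and $\ell\ge 0$ define the master function $$\Phi(t_1,\dots,t_\ell;\boldsymbol\mu;\boldsymbol w;\boldsymbol k)=e^{\mu_1(k_1w_1+k_2w_2)+(\mu_2-\mu_1)\sum_j t_j}\,(w_1-w_2)^{k_1k_2}\prod_{j=1}^{\ell}(t_j-w_1)^{-k_1}(t_j-w_2)^{-k_2}\prod_{1\le j<j'\le \ell}(t_j-t_{j'})^2 .$$ A point $t\in\mathbb C^\ell$ is admissible if $\Phi$ is well defined and nonzero at $t$; a critical point is a critical point with respect to $t$. A polynomial $y$ represents the orbit of $t$ under permutations of coordinates if $y=c\prod_j(x-t_j)$ with $c\neq0$. For $\boldsymbol\lambda,\boldsymbol z\in\mathbb C^2$, each with distinct coordinates, a space of the $(\boldsymbol\lambda,\boldsymbol z,\boldsymbol n,\boldsymbol m)$-type is a space $V=\langle p_1(x)e^{\lambda_1x},p_2(x)e^{\lambda_2x}\rangle$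 with $p_i\in\mathbb C[x]$, $\deg p_i=n_i$, such that the set of orders of vanishing at a point $x$ of the nonzero functions in $V$ is $\{0,m_a+1\}$ if $x=z_a$, and $\{0,1\}$ if $x\notin\{z_1,z_2\}$. Its special bispectral dual is the space $U$ spanned by the functions $$u\mapsto\int_{\gamma_a}e^{ux}\,\frac{f(x)}{{\rm Wr}_V(x)}\,\frac{dx}{(x-z_1)(x-z_2)},\qquad f\in V,\ a=1,2,$$ where ${\rm Wr}_V$ is the Wronskian of a basis of $V$ and $\gamma_a$ is a small circle around $z_a$. Theorem. There is a nonzero polynomial $P$ in $\lambda_1,\lambda_2,z_1,z_2$, depending only on $\boldsymbol n,\boldsymbol m$, such that the following holds whenever $P(\boldsymbol\lambda,\boldsymbol z)\ne0$ (that is, for generic $\boldsymbol\lambda,\boldsymbol z$). Let $(t_1,\dots,t_{n_2})$ be an admissible critical point of $\Phi(\,\cdot\,;\boldsymbol\lambda;\boldsymbol z;\boldsymbol m)$ and let $y=\prod_{j}(x-t_j)$. Then there is a space $V$ of the $(\boldsymbol\lambda,\boldsymbol z,\boldsymbol n,\boldsymbol m)$-type associated with it, i.e. annihilated by $$\Bigl(\partial_x-\ln'\frac{e^{\lambda_1x}(x-z_1)^{m_1}(x-z_2)^{m_2}}{y}\Bigr)\bigl(\partial_x-\ln'(y\,e^{\lambda_2x})\bigr).$$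 For every such $V$, the special bispectral dual $U$ has the form $\langle q_1(u)e^{z_1u},q_2(u)e^{z_2u}\rangle$ with polynomials $q_1,q_2$, and whenever $V=\langle p_1e^{\lambda_1x},p_2e^{\lambda_2x}\rangle$ and $U=\langle q_1e^{z_1u},q_2e^{z_2u}\rangle$ with polynomials $p_i,q_a$: (1) $p_1$ represents the orbit of an admissible critical point of $\Phi(t_1,\dots,t_{n_1};(\lambda_2,\lambda_1);\boldsymbol z;\boldsymbol m)$, and $p_1$ has no root in $\{z_1,z_2\}$; (2) $q_2$ represents the orbit of an admissible critical point of $\Phi(t_1,\dots,t_{m_2};\boldsymbol z;\boldsymbol\lambda;\boldsymbol n)$, and $q_2$ has no root in $\{\lambda_1,\lambda_2\}$. -/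

import Mathlib

open Polynomial

noncomputable section

namespace GaudinDuality

/-- The master function `Φ(t₁,…,t_k; μ; z; m)` (the case of two exponents and two points):
`exp(μ₁(m₁z₁ + m₂z₂) + (μ₂ - μ₁) ∑ t_j) (z₁ - z₂)^(m₁m₂)
  ∏ (t_j - z₁)^(-m₁) (t_j - z₂)^(-m₂) ∏_{j < j'} (t_j - t_{j'})²`. -/
def masterFunction {k : ℕ} (mu z : Fin 2 → ℂ) (m : Fin 2 → ℕ) (t : Fin k → ℂ) : ℂ :=
  Complex.exp (mu 0 * (m 0 * z 0 + m 1 * z 1) + (mu 1 - mu 0) * ∑ j, t j)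
    * (z 0 - z 1) ^ (m 0 * m 1)
    * (∏ j, (t j - z 0) ^ (-(m 0 : ℤ)) * (t j - z 1) ^ (-(m 1 : ℤ)))
    * ∏ j, ∏ j' ∈ Finset.Ioi j, (t j - t j') ^ 2

/-- `t` is admissible: the value of the master function at `t` is well defined
(no zero is raised to a negative power) and is not zero. -/
def IsAdmissible {k : ℕ} (mu z : Fin 2 → ℂ) (m : Fin 2 → ℕ) (t : Fin k → ℂ) : Prop :=
  (∀ j a, m a ≠ 0 → t j ≠ z a) ∧ masterFunction mu z m t ≠ 0

/-- `t` is a critical point of the master function, as a function of `t`. -/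
def IsCriticalPoint {k : ℕ} (mu z : Fin 2 → ℂ) (m : Fin 2 → ℕ) (t : Fin k → ℂ) : Prop :=
  HasFDerivAt (𝕜 := ℂ) (masterFunction mu z m) (0 : (Fin k → ℂ) →L[ℂ] ℂ) t

/-- The polynomial `y` (taken up to a nonzero factor) represents the orbit of `t` under
permutations of coordinates. -/
def Represents {k : ℕ} (y : ℂ[X]) (t : Fin k → ℂ) : Prop :=
  ∃ c : ℂ, c ≠ 0 ∧ y = C c * ∏ j, (X - C (t j))

/-- `y` represents the orbit of an admissible critical point of `Φ(t₁,…,t_k; μ; z; m)`, and is an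
admissible polynomial: it has no root in `{z₁, z₂}`. (The last clause adds something to the
admissibility of the point only if `m₁ = 0` or `m₂ = 0`; multiple roots are already excluded.) -/
def RepresentsAdmissibleCriticalPoint (k : ℕ) (mu z : Fin 2 → ℂ) (m : Fin 2 → ℕ)
    (y : ℂ[X]) : Prop :=
  (∃ t : Fin k → ℂ, Represents y t ∧ IsAdmissible mu z m t ∧ IsCriticalPoint mu z m t) ∧
    ∀ a, y.eval (z a) ≠ 0

/-- The space `⟨p₁(x) e^(μ₁x), p₂(x) e^(μ₂x)⟩`. -/
def quasiSpan (mu : Fin 2 → ℂ) (p : Fin 2 → ℂ[X]) : Submodule ℂ (ℂ → ℂ) :=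
  Submodule.span ℂ (Set.range fun (i : Fin 2) (x : ℂ) => (p i).eval x * Complex.exp (mu i * x))

/-- The set of exponents of `V` at `x`: all orders at `x` of the functions in `V`. -/
def exponents (V : Submodule ℂ (ℂ → ℂ)) (x : ℂ) : Set ℤ :=
  {e | ∃ f ∈ V, meromorphicOrderAt f x = (e : WithTop ℤ)}

/-- `(V, z)` is a space of the `(μ, z, n, m)`-type (a special space), with `N = M = 2`. -/
structure IsSpecialSpace (mu z : Fin 2 → ℂ) (n m : Fin 2 → ℕ)
    (V : Submodule ℂ (ℂ → ℂ)) : Prop where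
  mu_injective : Function.Injective mu
  z_injective : Function.Injective z
  exists_basis : ∃ p : Fin 2 → ℂ[X], (∀ i, (p i).degree = n i) ∧ V = quasiSpan mu p
  exponents_regular : ∀ x, (∀ a, x ≠ z a) → exponents V x = {0, 1}
  exponents_at : ∀ a, exponents V (z a) = {0, 1 + (m a : ℤ)}

/-- The first order operator `∂_x - ln' g`. -/
def firstOrderOp (g f : ℂ → ℂ) : ℂ → ℂ := fun x => deriv f x - logDeriv g x * f x

/-- The monic operator
`(∂_x - ln'(e^(μ₁x) (x-z₁)^m₁ (x-z₂)^m₂ / y)) (∂_x - ln'(y e^(μ₂x)))`,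
where `y = (x - t₁)⋯(x - t_k)`. -/
def criticalPointOp {k : ℕ} (mu z : Fin 2 → ℂ) (m : Fin 2 → ℕ) (t : Fin k → ℂ)
    (f : ℂ → ℂ) : ℂ → ℂ :=
  firstOrderOp
    (fun x => Complex.exp (mu 0 * x) * (∏ a, (x - z a) ^ m a) / ∏ j, (x - t j))
    (firstOrderOp (fun x => (∏ j, (x - t j)) * Complex.exp (mu 1 * x)) f)

/-- `V` is the space of the `(μ, z, n, m)`-type associated with the orbit of `t`: its monic
fundamental operator (the monic operator of order `2 = dim V` that annihilates it) is
`criticalPointOp`. The equation is one between meromorphic functions, so it is required off the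
possible poles of the coefficients. -/
structure IsAssociatedSpace (mu z : Fin 2 → ℂ) (n m : Fin 2 → ℕ) (t : Fin (n 1) → ℂ)
    (V : Submodule ℂ (ℂ → ℂ)) : Prop where
  special : IsSpecialSpace mu z n m V
  annihilates : ∀ f ∈ V, ∀ x, (∀ a, x ≠ z a) → (∀ j, x ≠ t j) → criticalPointOp mu z m t f x = 0

/-- The Wronskian of two functions. -/
def wronskian (f g : ℂ → ℂ) : ℂ → ℂ := fun x => f x * deriv g x - deriv f x * g x

/-- The conjugate space `V⋆` of a two-dimensional space `V`: the span of the functions `f / Wr_V`,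
`f ∈ V`, where `Wr_V` is the Wronskian of a basis `g, h` of `V` (unique up to a constant). -/
def conjugateSpace (V : Submodule ℂ (ℂ → ℂ)) : Submodule ℂ (ℂ → ℂ) :=
  Submodule.span ℂ {F | ∃ f ∈ V, ∃ g ∈ V, ∃ h ∈ V, LinearIndependent ℂ ![g, h] ∧
    F = fun x => f x / wronskian g h x}

/-- The special bispectral dual `U` of `(V, z)`: the span of the functions
`u ↦ ∮_{γ_a} e^(ux) f(x) ∏_b (x - z_b)⁻¹ dx`, where `f ∈ V⋆` and `γ_a` is a small circle around
`z_a`, that is, one whose closed disc contains no other `z_b`. -/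
def specialBispectralDual (z : Fin 2 → ℂ) (V : Submodule ℂ (ℂ → ℂ)) : Submodule ℂ (ℂ → ℂ) :=
  Submodule.span ℂ {F | ∃ f ∈ conjugateSpace V, ∃ (a : Fin 2) (r : ℝ),
    0 < r ∧ (∀ b, b ≠ a → r < dist (z b) (z a)) ∧
    F = fun u => ∮ x in C(z a, r), Complex.exp (u * x) * f x * ∏ b, (x - z b)⁻¹}

end GaudinDuality

end

/-! Put `W_κ(p, y) = p' y - p y' + κ p y` and `T = (x - z₁)^(m₁) (x - z₂)^(m₂)`. For `V = ⟨p₁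
e^(λ₁x), p₂ e^(λ₂x)⟩` everything follows from the single equation `W_κ(p₁, p₂) = c T`, with `κ = λ₁
- λ₂` and `c ≠ 0`. At a root of `p₂` where `T ≠ 0`, this equation and its derivative say that the
root is simple and satisfies its Bethe ansatz equation
(`representsAdmissibleCriticalPoint_of_twistedWronskian`). Conversely, the Bethe equations allow
`p₁` to be found from `p₂` by interpolation (`exists_twistedWronskian_eq`). Since `W_(-κ)(y, p) =
-W_κ(p, y)`, the polynomial `p₁` gives a critical point for the exchanged exponents as soon as it
has no root at `z₁, z₂`.

For the dual, `f / Wr_V` is a combination of the functions `p_i e^(-λ_(i')x) / T`, where `i'` is the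
index other than `i`, so the contour integrals are residues of `e^(vx) p_i / ∏ (x - z_a)^(m_a+1)` at
`v = u - λ_(i')`. A function in `V` that vanishes at `z_a` vanishes there to order `m_a + 1` and
contributes nothing, so each point yields one function `g_a(u) e^(z_a u)`. The coefficients in `v`
of the total residue of `e^(vx) p_i / ∏ (x - z_a)^(m_a+1)` vanish as long as `x^n p_i / ∏ (x -
z_a)^(m_a+1)` is `O(x⁻²)`. This gives a combination of the `g_a e^(z_a u)` with a zero of order
`n_(i') + 1` at `λ_(i')`; hence `(u - λ_i)^(n_i)` divides `W(g₁, g₂)` for both `i`, and by degree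
there is no other factor (`exists_specialBispectralDual_eq`). So `U` satisfies the same equation
with the roles of exponents and points exchanged.

Genericity serves to keep the roots of `p₁` off `z_a` and those of `q₂` off `λ_i`. If `p(z_a) = 0`
and `y(z_a) ≠ 0`, then `(x - z_a)^(m_a+1)` divides `p`. After an affine change of variable this can
occur only for `κ (z_b - z_a)` in a finite set (`exceptionalSet_finite`): infinitely many values
would give a solution over a field with a valuation at which `κ` is infinite, and its reduction
would read `p y = x^k (x - 1)^l` with `x^(k+1)` dividing `p`. As `κ (z_b - z_a) = ±(λ₁ - λ₂)(z₁ -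
z₂)`, finitely many values of one polynomial are excluded. -/

noncomputable section

namespace GaudinDuality

/-! ### Algebra of the twisted Wronskian: degrees, multiplicities, first order equations. -/

section TwistedWronskian

variable {R : Type*} [CommRing R]

/-- The polynomial `p' y - p y' + κ p y`; if `κ = λ - μ` then `e^((λ + μ) x)` times it is
`(p e^(λ x))' (y e^(μ x)) - (p e^(λ x)) (y e^(μ x))'`. -/
def twistedWronskian (κ : R) (p y : R[X]) : R[X] :=
  derivative p * y - p * derivative y + C κ * p * y

lemma twistedWronskian_swap (κ : R) (p y : R[X]) :
    twistedWronskian (-κ) y p = -twistedWronskian κ p y := by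
  simp only [twistedWronskian, C_neg]; ring

lemma twistedWronskian_C_mul_left (κ a : R) (p y : R[X]) :
    twistedWronskian κ (C a * p) y = C a * twistedWronskian κ p y := by
  simp only [twistedWronskian, derivative_C_mul]; ring

lemma twistedWronskian_C_mul_right (κ a : R) (p y : R[X]) :
    twistedWronskian κ p (C a * y) = C a * twistedWronskian κ p y := by
  simp only [twistedWronskian, derivative_C_mul]; ring

lemma twistedWronskian_add_left (κ : R) (p q y : R[X]) :
    twistedWronskian κ (p + q) y = twistedWronskian κ p y + twistedWronskian κ q y := by
  simp only [twistedWronskian, derivative_add]; ring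

lemma twistedWronskian_mul_self (κ : R) (r y : R[X]) :
    twistedWronskian κ (y * r) y = y ^ 2 * (derivative r + C κ * r) := by
  simp only [twistedWronskian, derivative_mul]; ring

end TwistedWronskian

section Field

variable {F : Type*} [Field F]

lemma degree_twistedWronskian_sub_lt {κ : F} {p y : F[X]} (hp : p ≠ 0) (hy : y ≠ 0) :
    (twistedWronskian κ p y - C κ * p * y).degree < (p * y).degree := by
  have h : twistedWronskian κ p y - C κ * p * y = -(Polynomial.wronskian p y) := by
    simp only [twistedWronskian, Polynomial.wronskian]; ring
  rw [h, degree_neg, degree_mul]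
  exact degree_wronskian_lt_add hp hy

lemma degree_twistedWronskian {κ : F} (hκ : κ ≠ 0) {p y : F[X]} (hp : p ≠ 0) (hy : y ≠ 0) :
    (twistedWronskian κ p y).degree = (p * y).degree := by
  have h1 : (C κ * p * y).degree = (p * y).degree := by
    rw [mul_assoc, degree_C_mul hκ]
  have h2 : twistedWronskian κ p y
      = (twistedWronskian κ p y - C κ * p * y) + C κ * p * y := by ring
  rw [h2, degree_add_eq_right_of_degree_lt, h1]
  rw [h1]; exact degree_twistedWronskian_sub_lt hp hy

lemma natDegree_twistedWronskian {κ : F} (hκ : κ ≠ 0) {p y : F[X]} (hp : p ≠ 0) (hy : y ≠ 0) :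
    (twistedWronskian κ p y).natDegree = p.natDegree + y.natDegree := by
  rw [← natDegree_mul hp hy]
  exact natDegree_eq_of_degree_eq (degree_twistedWronskian hκ hp hy)

lemma leadingCoeff_twistedWronskian {κ : F} (hκ : κ ≠ 0) {p y : F[X]} (hp : p ≠ 0) (hy : y ≠ 0) :
    (twistedWronskian κ p y).leadingCoeff = κ * (p.leadingCoeff * y.leadingCoeff) := by
  have h1 : (C κ * p * y).degree = (p * y).degree := by
    rw [mul_assoc, degree_C_mul hκ]
  have h2 : twistedWronskian κ p y
      = (twistedWronskian κ p y - C κ * p * y) + C κ * p * y := by ring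
  rw [h2, leadingCoeff_add_of_degree_lt]
  · simp [leadingCoeff_mul, mul_assoc]
  · rw [h1]; exact degree_twistedWronskian_sub_lt hp hy

lemma twistedWronskian_ne_zero {κ : F} (hκ : κ ≠ 0) {p y : F[X]} (hp : p ≠ 0) (hy : y ≠ 0) :
    twistedWronskian κ p y ≠ 0 := by
  rw [Ne, ← degree_eq_bot, degree_twistedWronskian hκ hp hy, degree_eq_bot]
  exact mul_ne_zero hp hy

lemma eq_zero_of_twistedWronskian_eq_zero {κ : F} (hκ : κ ≠ 0) {p y : F[X]} (hy : y ≠ 0)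
    (h : twistedWronskian κ p y = 0) : p = 0 := by
  by_contra hp
  exact twistedWronskian_ne_zero hκ hp hy h

/-- The operator `x d/dx` multiplies the leading coefficient by the degree, so the top coefficients
of `x w' T` and `x w T'` differ by the factor `deg w` against `deg T`. -/
lemma natDegree_eq_of_wronskian_eq_zero [CharZero F] {w T : F[X]} (hw : w ≠ 0) (hT : T ≠ 0)
    (h : derivative w * T = w * derivative T) : w.natDegree = T.natDegree := by
  have key : ∀ f : F[X], (X * derivative f).natDegree ≤ f.natDegree ∧
      (X * derivative f).coeff f.natDegree = f.natDegree * f.leadingCoeff := by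
    intro f
    have hc : ∀ i, (X * derivative f).coeff i = i * f.coeff i := by
      intro i
      cases i with
      | zero => simp
      | succ i => rw [coeff_X_mul, coeff_derivative]; push_cast; ring
    refine ⟨natDegree_le_iff_coeff_eq_zero.2 fun i hi => ?_, hc _⟩
    rw [hc, coeff_eq_zero_of_natDegree_lt hi, mul_zero]
  have h1 : (X * derivative w) * T = w * (X * derivative T) := by linear_combination X * h
  have h2 := congrArg (fun f => f.coeff (w.natDegree + T.natDegree)) h1
  rw [coeff_mul_add_eq_of_natDegree_le (key w).1 le_rfl, coeff_mul_add_eq_of_natDegree_le le_rfl (key T).1,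
    (key w).2, (key T).2, coeff_natDegree, coeff_natDegree] at h2
  have hw' := leadingCoeff_ne_zero.2 hw
  have hT' := leadingCoeff_ne_zero.2 hT
  have h3 : ((w.natDegree : F) - T.natDegree) * (w.leadingCoeff * T.leadingCoeff) = 0 := by
    linear_combination h2
  have h4 := (mul_eq_zero.1 h3).resolve_right (mul_ne_zero hw' hT')
  exact_mod_cast sub_eq_zero.1 h4

lemma exists_eq_C_mul_of_wronskian_eq_zero [CharZero F] {w T : F[X]} (hT : T ≠ 0)
    (h : derivative w * T = w * derivative T) : ∃ c : F, w = C c * T := by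
  -- This constant removes the coefficient of `w` at `deg T`; a nonzero difference `w - c T` would
  -- still have zero Wronskian with `T`, hence degree `deg T`.
  refine ⟨w.coeff T.natDegree / T.leadingCoeff, ?_⟩
  set c := w.coeff T.natDegree / T.leadingCoeff
  have hT' := leadingCoeff_ne_zero.2 hT
  by_contra hne
  have hD : w - C c * T ≠ 0 := sub_ne_zero.2 hne
  have hdeg := natDegree_eq_of_wronskian_eq_zero (w := w - C c * T) hD hT (by
    simp only [derivative_sub, derivative_C_mul]; linear_combination h)
  have h0 : (w - C c * T).coeff T.natDegree = 0 := by
    rw [coeff_sub, coeff_C_mul, coeff_natDegree, div_mul_cancel₀ _ hT', sub_self]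
  rw [← hdeg, coeff_natDegree, leadingCoeff_eq_zero] at h0
  exact hD h0

/-- If `p ≠ 0` has a zero of order `e ≥ 1` at `a` and `y(a) ≠ 0`, then `p' y` dominates and the
twisted Wronskian has order exactly `e - 1` there. -/
lemma pow_succ_dvd_of_pow_dvd_twistedWronskian [CharZero F] {κ a : F} {k : ℕ} {p y : F[X]}
    (h : (X - C a) ^ k ∣ twistedWronskian κ p y) (hp : p.eval a = 0) (hy : y.eval a ≠ 0) :
    (X - C a) ^ (k + 1) ∣ p := by
  rcases eq_or_ne p 0 with rfl | hp0
  · exact dvd_zero _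
  obtain ⟨q, hq, hnd⟩ := exists_eq_pow_rootMultiplicity_mul_and_not_dvd p hp0 a
  set e := p.rootMultiplicity a with he
  have he1 : 0 < e := (rootMultiplicity_pos hp0).2 hp
  obtain ⟨e', he'⟩ : ∃ e', e = e' + 1 := ⟨e - 1, by omega⟩
  by_cases hek : k + 1 ≤ e
  · rw [hq]; exact Dvd.dvd.mul_right (pow_dvd_pow _ hek) _
  exfalso
  have hfac : twistedWronskian κ p y = (X - C a) ^ e' *
      (C ((e' + 1 : ℕ) : F) * q * y + (X - C a) * twistedWronskian κ q y) := by
    rw [hq, he', twistedWronskian, twistedWronskian]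
    simp only [derivative_mul, derivative_X_sub_C_pow, Nat.add_sub_cancel]
    ring
  have h1 : (X - C a) ^ (e' + 1) ∣ twistedWronskian κ p y :=
    (pow_dvd_pow _ (by omega)).trans h
  rw [hfac, pow_succ] at h1
  have h2 := (mul_dvd_mul_iff_left (pow_ne_zero e' (X_sub_C_ne_zero a))).1 h1
  rw [dvd_iff_isRoot, IsRoot.def] at h2
  simp only [eval_add, eval_mul, eval_sub, eval_X, eval_C, sub_self, zero_mul, add_zero] at h2
  rw [dvd_iff_isRoot, IsRoot.def] at hnd
  exact (mul_ne_zero (mul_ne_zero (Nat.cast_ne_zero.2 (Nat.succ_ne_zero e')) hnd) hy) h2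

lemma exists_derivative_add_C_mul_eq {κ : F} (hκ : κ ≠ 0) (s : F[X]) :
    ∃ r : F[X], derivative r + C κ * r = s := by
  suffices H : ∀ n : ℕ, ∀ s : F[X], s.degree < n → ∃ r : F[X], derivative r + C κ * r = s from
    H (s.natDegree + 1) s (degree_le_natDegree.trans_lt (by exact_mod_cast Nat.lt_succ_self _))
  intro n
  induction n with
  | zero =>
    intro s hs
    have h0 : s = 0 := by simpa using hs
    exact ⟨0, by simp [h0]⟩
  | succ n ih =>
    intro s hs
    have hd : (derivative s).degree < n := by
      rcases eq_or_ne s 0 with rfl | hs0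
      · simp [bot_lt_iff_ne_bot]
      · refine (degree_derivative_lt hs0).trans_le ?_
        rw [degree_eq_natDegree hs0] at hs ⊢
        exact_mod_cast Nat.lt_succ_iff.1 (by exact_mod_cast hs)
    obtain ⟨r, hr⟩ := ih (derivative s) hd
    -- With `r' + κ r = s'` from the induction on the degree, this solves the equation for `s`.
    refine ⟨C κ⁻¹ * (s - r), ?_⟩
    have hC : C κ * C κ⁻¹ = (1 : F[X]) := by rw [← C_mul, mul_inv_cancel₀ hκ, C_1]
    simp only [derivative_C_mul, derivative_sub]
    linear_combination (-C κ⁻¹) * hr + s * hC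

lemma eval_derivative_prod_eq {ι : Type*} [DecidableEq ι] (s : Finset ι) (f : ι → F[X]) (x : F)
    (h : ∀ i ∈ s, (f i).eval x ≠ 0) :
    (derivative (∏ i ∈ s, f i)).eval x
      = (∏ i ∈ s, f i).eval x * ∑ i ∈ s, (derivative (f i)).eval x / (f i).eval x := by
  induction s using Finset.induction_on with
  | empty => simp
  | insert a s ha ih =>
    have h1 := h a (Finset.mem_insert_self a s)
    rw [Finset.prod_insert ha, Finset.sum_insert ha, derivative_mul, eval_add, eval_mul, eval_mul,
      ih (fun i hi => h i (Finset.mem_insert_of_mem hi)), eval_mul]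
    field_simp

end Field

/-! ### The Bethe ansatz equations and the Wronskian equation. -/

/-- The polynomial `(x - z₁)^(m₁) (x - z₂)^(m₂)`. -/
def fusionPoly (z : Fin 2 → ℂ) (m : Fin 2 → ℕ) : ℂ[X] := ∏ a, (X - C (z a)) ^ m a

lemma fusionPoly_monic (z : Fin 2 → ℂ) (m : Fin 2 → ℕ) : (fusionPoly z m).Monic :=
  monic_prod_of_monic _ _ fun a _ => (monic_X_sub_C (z a)).pow _

lemma fusionPoly_ne_zero (z : Fin 2 → ℂ) (m : Fin 2 → ℕ) : fusionPoly z m ≠ 0 :=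
  (fusionPoly_monic z m).ne_zero

lemma natDegree_fusionPoly (z : Fin 2 → ℂ) (m : Fin 2 → ℕ) :
    (fusionPoly z m).natDegree = m 0 + m 1 := by
  rw [fusionPoly, natDegree_prod_of_monic _ _ fun a _ => (monic_X_sub_C (z a)).pow _]
  simp

lemma eval_fusionPoly (z : Fin 2 → ℂ) (m : Fin 2 → ℕ) (x : ℂ) :
    (fusionPoly z m).eval x = ∏ a, (x - z a) ^ m a := by
  simp [fusionPoly]

lemma eval_fusionPoly_ne_zero {z : Fin 2 → ℂ} {m : Fin 2 → ℕ} {x : ℂ} :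
    (fusionPoly z m).eval x ≠ 0 ↔ ∀ a, m a ≠ 0 → x ≠ z a := by
  rw [eval_fusionPoly, Finset.prod_ne_zero_iff]
  refine ⟨fun h a ha hx => h a (Finset.mem_univ _) (by rw [hx, sub_self, zero_pow ha]),
    fun h a _ => ?_⟩
  rcases eq_or_ne (m a) 0 with h0 | h0
  · simp [h0]
  · exact pow_ne_zero _ (sub_ne_zero.2 (h a h0))

lemma eval_derivative_fusionPoly {z : Fin 2 → ℂ} {m : Fin 2 → ℕ} {x : ℂ}
    (h : (fusionPoly z m).eval x ≠ 0) :
    (derivative (fusionPoly z m)).eval x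
      = (fusionPoly z m).eval x * ∑ a, (m a : ℂ) / (x - z a) := by
  have h' := eval_fusionPoly_ne_zero.1 h
  rw [fusionPoly, eval_derivative_prod_eq]
  · congr 1
    refine Finset.sum_congr rfl fun a _ => ?_
    rcases Nat.eq_zero_or_pos (m a) with h0 | h0
    · simp [h0]
    · have hx := sub_ne_zero.2 (h' a h0.ne')
      obtain ⟨k, hk⟩ : ∃ k, m a = k + 1 := ⟨m a - 1, by omega⟩
      rw [hk, derivative_X_sub_C_pow]
      simp only [Nat.add_sub_cancel, eval_mul, eval_pow, eval_sub, eval_X, eval_C]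
      field_simp
      ring
  · intro a _
    rw [eval_pow, eval_sub, eval_X, eval_C]
    rcases eq_or_ne (m a) 0 with h0 | h0
    · simp [h0]
    · exact pow_ne_zero _ (sub_ne_zero.2 (h' a h0))

/-- The left hand side of the `j`-th Bethe ansatz equation, the logarithmic derivative of the
master function with respect to `t_j`. -/
def betheExpr {k : ℕ} (mu z : Fin 2 → ℂ) (m : Fin 2 → ℕ) (t : Fin k → ℂ) (j : Fin k) : ℂ :=
  (mu 1 - mu 0) - ∑ a, (m a : ℂ) / (t j - z a) + ∑ i ∈ {j}ᶜ, 2 / (t j - t i)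

section Roots

variable {k : ℕ} {t : Fin k → ℂ}

lemma eval_derivative_prod_X_sub_C (ht : Function.Injective t) (j : Fin k) :
    (derivative (∏ i, (X - C (t i)))).eval (t j) ≠ 0 ∧
    (derivative (derivative (∏ i, (X - C (t i))))).eval (t j)
      = (derivative (∏ i, (X - C (t i)))).eval (t j) * ∑ i ∈ {j}ᶜ, 2 / (t j - t i) := by
  set g : ℂ[X] := ∏ i ∈ {j}ᶜ, (X - C (t i)) with hg
  have hy : ∏ i, (X - C (t i)) = (X - C (t j)) * g := by
    rw [hg, Fintype.prod_eq_mul_prod_compl j]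
  have hne : ∀ i ∈ ({j}ᶜ : Finset (Fin k)), (X - C (t i)).eval (t j) ≠ 0 := by
    intro i hi
    rw [eval_sub, eval_X, eval_C]
    refine sub_ne_zero.2 fun h => ?_
    simp only [Finset.mem_compl, Finset.mem_singleton] at hi
    exact hi (ht h).symm
  have hgne : g.eval (t j) ≠ 0 := by
    rw [hg, eval_prod]; exact Finset.prod_ne_zero_iff.2 hne
  have h1 : (derivative (∏ i, (X - C (t i)))).eval (t j) = g.eval (t j) := by
    rw [hy]; simp
  have h2 : (derivative (derivative (∏ i, (X - C (t i))))).eval (t j)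
      = 2 * (derivative g).eval (t j) := by
    rw [hy]; simp; ring
  refine ⟨h1 ▸ hgne, ?_⟩
  rw [h1, h2, hg, eval_derivative_prod_eq _ _ _ hne, Finset.mul_sum, Finset.mul_sum,
    Finset.mul_sum]
  refine Finset.sum_congr rfl fun i _ => ?_
  simp; ring

/-- At a simple root `t_j` of `y`, `y''/y'` is the sum of `2/(t_j - t_i)` and `T'/T` is the sum of
`m_a/(t_j - z_a)`. Multiplying by `-T y'` clears the denominators. -/
lemma betheExpr_eq_zero_iff {mu z : Fin 2 → ℂ} {m : Fin 2 → ℕ} (ht : Function.Injective t)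
    {j : Fin k} (hT : (fusionPoly z m).eval (t j) ≠ 0) :
    betheExpr mu z m t j = 0 ↔
      (derivative (fusionPoly z m)).eval (t j) * (derivative (∏ i, (X - C (t i)))).eval (t j)
        - (fusionPoly z m).eval (t j) * (derivative (derivative (∏ i, (X - C (t i))))).eval (t j)
        + (mu 0 - mu 1) * (fusionPoly z m).eval (t j)
          * (derivative (∏ i, (X - C (t i)))).eval (t j) = 0 := by
  obtain ⟨h1, h2⟩ := eval_derivative_prod_X_sub_C ht j
  rw [h2, eval_derivative_fusionPoly hT]
  have : ∀ A B c d S1 S2 : ℂ, A * S1 * B - A * (B * S2) + (c - d) * A * B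
      = -(A * B) * (d - c - S1 + S2) := by intros; ring
  rw [this, mul_eq_zero, or_iff_right (neg_ne_zero.2 (mul_ne_zero hT h1)), betheExpr]

/-- Interpolation solves the equation modulo `y`, and the Bethe equations improve this to modulo
`y²`. The remaining multiple of `y²` is absorbed by a correction `y r`, whose twisted Wronskian with
`y` is `y² (r' + κ r)`. -/
lemma exists_twistedWronskian_eq {κ : ℂ} (hκ : κ ≠ 0) (ht : Function.Injective t) (T : ℂ[X])
    (h : ∀ j, (derivative T).eval (t j) * (derivative (∏ i, (X - C (t i)))).eval (t j)
        - T.eval (t j) * (derivative (derivative (∏ i, (X - C (t i))))).eval (t j)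
        + κ * T.eval (t j) * (derivative (∏ i, (X - C (t i)))).eval (t j) = 0) :
    ∃ p, twistedWronskian κ p (∏ i, (X - C (t i))) = T := by
  set y : ℂ[X] := ∏ i, (X - C (t i)) with hy
  have hroot : ∀ j, y.eval (t j) = 0 := fun j => by
    rw [hy, eval_prod]; exact Finset.prod_eq_zero (Finset.mem_univ j) (by simp)
  have hd : ∀ j, (derivative y).eval (t j) ≠ 0 := fun j => (eval_derivative_prod_X_sub_C ht j).1
  -- At a root of `y` the equation reads `-p y' = T`, which prescribes these values.
  set p₀ : ℂ[X] := Lagrange.interpolate Finset.univ t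
    (fun j => -T.eval (t j) / (derivative y).eval (t j)) with hp₀
  have hp₀e : ∀ j, p₀.eval (t j) * (derivative y).eval (t j) = -T.eval (t j) := fun j => by
    rw [hp₀, Lagrange.eval_interpolate_at_node _ ht.injOn (Finset.mem_univ j),
      div_mul_cancel₀ _ (hd j)]
  have hdvd : y ^ 2 ∣ T - twistedWronskian κ p₀ y := by
    rw [hy, ← Finset.prod_pow]
    refine Finset.prod_dvd_of_coprime ?_ ?_
    · intro i _ j _ hij
      exact (isCoprime_X_sub_C_of_isUnit_sub (sub_ne_zero.2 (ht.ne hij)).isUnit).pow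
    · intro j _
      rw [← hy]
      set f := T - twistedWronskian κ p₀ y with hf
      have e0 : f.eval (t j) = 0 := by
        simp only [hf, twistedWronskian, eval_sub, eval_add, eval_mul, hroot, eval_C]
        linear_combination hp₀e j
      have e1 : (derivative f).eval (t j) = 0 := by
        refine (mul_eq_zero.1 (?_ : _ * (derivative y).eval (t j) = 0)).resolve_right (hd j)
        simp only [hf, twistedWronskian, eval_sub, eval_add, eval_mul, hroot, eval_C,
          derivative_sub, derivative_add, derivative_mul, derivative_C]
        linear_combination h j + ((derivative (derivative y)).eval (t j)
          - κ * (derivative y).eval (t j)) * hp₀e j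
      obtain ⟨g, hg⟩ := dvd_iff_isRoot.2 e0
      rw [hg] at e1 ⊢
      rw [sq]
      refine mul_dvd_mul_left _ (dvd_iff_isRoot.2 ?_)
      simpa using e1
  obtain ⟨s, hs⟩ := hdvd
  obtain ⟨r, hr⟩ := exists_derivative_add_C_mul_eq hκ s
  refine ⟨p₀ + y * r, ?_⟩
  rw [twistedWronskian_add_left, twistedWronskian_mul_self, hr, ← hs]; ring

end Roots

/-- At a root of `y` the equation gives `-p y' = c T`, so `y' ≠ 0`; eliminating `p` between this and
the differentiated equation leaves a condition on `y` and `T` alone. -/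
lemma derivative_conditions_of_twistedWronskian_eq {κ c x : ℂ} {p y T : ℂ[X]} (hc : c ≠ 0)
    (h : twistedWronskian κ p y = C c * T) (hy : y.eval x = 0) (hT : T.eval x ≠ 0) :
    (derivative y).eval x ≠ 0 ∧
      (derivative T).eval x * (derivative y).eval x - T.eval x * (derivative (derivative y)).eval x
        + κ * T.eval x * (derivative y).eval x = 0 := by
  have h0 := congrArg (eval x) h
  have h1 := congrArg (fun f => eval x (derivative f)) h
  simp only [twistedWronskian, eval_sub, eval_add, eval_mul, hy, eval_C,
          derivative_sub, derivative_add, derivative_mul, derivative_C, eval_zero] at h0 h1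
  constructor
  · intro hd
    rw [hd] at h0
    exact (mul_ne_zero hc hT) (by linear_combination -h0)
  · refine (mul_eq_zero.1 (?_ : c * _ = 0)).resolve_left hc
    linear_combination (-(derivative y).eval x) * h1 + ((derivative (derivative y)).eval x
      - κ * (derivative y).eval x) * h0

/-! ### Critical points of the master function. -/

section LogFDeriv

variable {E : Type*} [NormedAddCommGroup E] [NormedSpace ℂ E]

/-- Derivatives are kept in the form value times logarithmic derivative, so that products turn into
sums without choosing a branch of the logarithm. -/
lemma hasFDerivAt_smul_mul {f g : E → ℂ} {A B : E →L[ℂ] ℂ} {x : E}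
    (hf : HasFDerivAt f (f x • A) x) (hg : HasFDerivAt g (g x • B) x) :
    HasFDerivAt (fun x => f x * g x) ((f x * g x) • (A + B)) x := by
  refine (hf.mul hg).congr_fderiv ?_
  ext v; simp; ring

lemma hasFDerivAt_smul_finset_prod {ι : Type*} [DecidableEq ι] (s : Finset ι) {f : ι → E → ℂ}
    {A : ι → E →L[ℂ] ℂ} {x : E} (hf : ∀ i ∈ s, HasFDerivAt (f i) (f i x • A i) x) :
    HasFDerivAt (fun x => ∏ i ∈ s, f i x) ((∏ i ∈ s, f i x) • ∑ i ∈ s, A i) x := by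
  induction s using Finset.induction_on with
  | empty => simpa using hasFDerivAt_const (1 : ℂ) x
  | insert a s ha ih =>
    simp only [Finset.prod_insert ha, Finset.sum_insert ha]
    exact hasFDerivAt_smul_mul (hf a (Finset.mem_insert_self a s))
      (ih fun i hi => hf i (Finset.mem_insert_of_mem hi))

end LogFDeriv

variable {k : ℕ} {mu z : Fin 2 → ℂ} {m : Fin 2 → ℕ} {t : Fin k → ℂ}

lemma isAdmissible_iff (hz : z 0 ≠ z 1) :
    IsAdmissible mu z m t ↔ (∀ j a, m a ≠ 0 → t j ≠ z a) ∧ Function.Injective t := by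
  unfold IsAdmissible
  refine and_congr_right fun h => ?_
  have h1 : ∀ j, (t j - z 0) ^ (-(m 0 : ℤ)) * (t j - z 1) ^ (-(m 1 : ℤ)) ≠ 0 := by
    have h2 : ∀ j a, (t j - z a) ^ (-(m a : ℤ)) ≠ 0 := by
      intro j a
      rcases eq_or_ne (m a) 0 with h0 | h0
      · simp [h0]
      · exact zpow_ne_zero _ (sub_ne_zero.2 (h j a h0))
    exact fun j => mul_ne_zero (h2 j 0) (h2 j 1)
  unfold masterFunction
  rw [mul_ne_zero_iff, and_iff_right]
  · rw [Finset.prod_ne_zero_iff]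
    constructor
    · intro H i j hij
      by_contra hne
      wlog hlt : i < j generalizing i j
      · exact this hij.symm (Ne.symm hne) (lt_of_le_of_ne (not_lt.1 hlt) (Ne.symm hne))
      have := (Finset.prod_ne_zero_iff.1 (H i (Finset.mem_univ i))) j (Finset.mem_Ioi.2 hlt)
      exact this (by simp [hij])
    · intro H i _
      refine Finset.prod_ne_zero_iff.2 fun j hj => pow_ne_zero _ (sub_ne_zero.2 (H.ne ?_))
      exact (Finset.mem_Ioi.1 hj).ne
  · refine mul_ne_zero (mul_ne_zero (Complex.exp_ne_zero _) (pow_ne_zero _ (sub_ne_zero.2 hz))) ?_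
    exact Finset.prod_ne_zero_iff.2 fun j _ => h1 j

lemma hasFDerivAt_masterFunction (h : ∀ j a, m a ≠ 0 → t j ≠ z a) (ht : Function.Injective t) :
    HasFDerivAt (𝕜 := ℂ) (masterFunction mu z m)
      (masterFunction mu z m t •
        ∑ j, betheExpr mu z m t j • (ContinuousLinearMap.proj j : (Fin k → ℂ) →L[ℂ] ℂ)) t := by
  set pr : Fin k → ((Fin k → ℂ) →L[ℂ] ℂ) :=
    fun j => ContinuousLinearMap.proj j with hpr
  have hp : ∀ j, HasFDerivAt (𝕜 := ℂ) (fun t : Fin k → ℂ => t j) (pr j) t := fun j =>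
    (pr j).hasFDerivAt
  have hz : ∀ j a, HasFDerivAt (𝕜 := ℂ) (fun t : Fin k → ℂ => (t j - z a) ^ (-(m a : ℤ)))
      ((t j - z a) ^ (-(m a : ℤ)) • ((-(m a : ℂ) / (t j - z a)) • pr j)) t := by
    intro j a
    -- When `m_a = 0` the point `t_j` may equal `z_a`; the factor is then the constant `1`.
    rcases eq_or_ne (m a) 0 with h0 | h0
    · refine ((hasFDerivAt_const (1 : ℂ) t).congr_of_eventuallyEq
        (.of_forall fun x => by simp [h0])).congr_fderiv ?_
      ext v
      simp [h0]
    · have hne := sub_ne_zero.2 (h j a h0)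
      have h1 := (hasDerivAt_zpow (-(m a : ℤ)) (t j - z a) (Or.inl hne)).comp_hasFDerivAt t
        ((hp j).sub_const (z a))
      refine h1.congr_fderiv ?_
      rw [smul_smul, zpow_sub_one₀ hne]
      congr 1
      push_cast
      field_simp
  have hd : ∀ j, ∀ j' ∈ Finset.Ioi j, HasFDerivAt (𝕜 := ℂ) (fun t : Fin k → ℂ => (t j - t j') ^ 2)
      ((t j - t j') ^ 2 • ((2 / (t j - t j')) • pr j + (2 / (t j' - t j)) • pr j')) t := by
    intro j j' hj
    have hne : t j - t j' ≠ 0 := sub_ne_zero.2 (ht.ne (Finset.mem_Ioi.1 hj).ne)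
    have hne' : t j' - t j ≠ 0 := sub_ne_zero.2 (ht.ne (Finset.mem_Ioi.1 hj).ne')
    have h1 := (hasDerivAt_pow 2 (t j - t j')).comp_hasFDerivAt t ((hp j).sub (hp j'))
    refine h1.congr_fderiv ?_
    ext v
    simp only [hpr, smul_apply, sub_apply, add_apply, ContinuousLinearMap.proj_apply, smul_eq_mul]
    have e : t j' - t j = -(t j - t j') := by ring
    rw [e]
    field_simp
    push_cast
    ring
  have hexp : HasFDerivAt (𝕜 := ℂ) (fun t : Fin k → ℂ =>
      Complex.exp (mu 0 * (m 0 * z 0 + m 1 * z 1) + (mu 1 - mu 0) * ∑ j, t j))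
      (Complex.exp (mu 0 * (m 0 * z 0 + m 1 * z 1) + (mu 1 - mu 0) * ∑ j, t j) •
        ((mu 1 - mu 0) • ∑ j, pr j)) t :=
    (((HasFDerivAt.fun_sum fun j _ => hp j).const_mul (mu 1 - mu 0)).const_add _).cexp
  have hexp' := hasFDerivAt_smul_mul hexp
    (g := fun _ => (z 0 - z 1) ^ (m 0 * m 1)) (B := 0)
    ((hasFDerivAt_const ((z 0 - z 1) ^ (m 0 * m 1)) t).congr_fderiv (by ext v; simp))
  have hall := hasFDerivAt_smul_mul (hasFDerivAt_smul_mul hexp'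
    (hasFDerivAt_smul_finset_prod Finset.univ fun j _ => hasFDerivAt_smul_mul (hz j 0) (hz j 1)))
    (hasFDerivAt_smul_finset_prod Finset.univ fun j _ =>
      hasFDerivAt_smul_finset_prod (Finset.Ioi j) (hd j))
  refine hall.congr_fderiv ?_
  unfold masterFunction
  congr 1
  -- Each pair `j < j'` contributes to both coordinates; the sum is regrouped over all ordered pairs
  -- of distinct indices.
  have hs := Finset.sum_sum_Ioi_add_eq_sum_sum_off_diag fun i j => (2 / (t j - t i)) • pr j
  rw [hs, add_zero, Finset.smul_sum, ← Finset.sum_add_distrib, ← Finset.sum_add_distrib]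
  refine Finset.sum_congr rfl fun j _ => ?_
  ext v
  simp only [betheExpr, hpr, add_apply, smul_apply, sum_apply, smul_eq_mul,
    ← Finset.sum_mul, Fin.sum_univ_two]
  ring

lemma isCriticalPoint_iff (hz : z 0 ≠ z 1) (hA : IsAdmissible mu z m t) :
    IsCriticalPoint mu z m t ↔ ∀ j, betheExpr mu z m t j = 0 := by
  obtain ⟨h, ht⟩ := (isAdmissible_iff hz).1 hA
  have hF := hasFDerivAt_masterFunction (mu := mu) h ht
  unfold IsCriticalPoint
  constructor
  · intro H j
    have h1 := hF.unique H
    have h2 := congrArg (fun L : (Fin k → ℂ) →L[ℂ] ℂ => L (Pi.single j 1)) h1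
    simpa [hA.2, Pi.single_apply] using h2
  · intro H
    refine hF.congr_fderiv ?_
    ext v
    simp [H]

/-! ### Finiteness of the exceptional parameters, by a valuation argument. -/

lemma twistedWronskian_map {R S : Type*} [CommRing R] [CommRing S] (f : R →+* S) (κ : R)
    (p y : R[X]) : (twistedWronskian κ p y).map f = twistedWronskian (f κ) (p.map f) (y.map f) := by
  simp [twistedWronskian, derivative_map]

lemma twistedWronskian_comp_affine {R : Type*} [CommRing R] (κ a b : R) (p y : R[X]) :
    C a * (twistedWronskian κ p y).comp (C a * X + C b)
      = twistedWronskian (κ * a) (p.comp (C a * X + C b)) (y.comp (C a * X + C b)) := by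
  simp only [twistedWronskian, sub_comp, add_comp, mul_comp, C_comp, derivative_comp,
    derivative_add, derivative_C_mul, derivative_X, derivative_C, C_mul]
  ring

lemma comp_C_mul_X_eq {K : Type*} [Field K] [IsAlgClosed K] {y : K[X]} (hy : y.Monic) {ρ : K}
    (hρ : ρ ≠ 0) : y.comp (C ρ * X + C 0)
      = C (ρ ^ y.natDegree) * ((y.roots.map fun a => a * ρ⁻¹).map fun a => X - C a).prod := by
  have h1 := (IsAlgClosed.splits y).eq_prod_roots_of_monic hy
  have h2 : y.natDegree = Multiset.card y.roots :=
    IsAlgClosed.card_roots_eq_natDegree.symm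
  rw [h2]
  conv_lhs => rw [h1]
  generalize y.roots = s
  induction s using Multiset.induction_on with
  | empty => simp
  | cons a s ih =>
    rw [Multiset.map_cons, Multiset.prod_cons, mul_comp, ih]
    simp only [Multiset.map_cons, Multiset.prod_cons, Multiset.card_cons, sub_comp,
      X_comp, C_comp, pow_succ, C_mul, C_0, add_zero]
    have hC : C ρ * C ρ⁻¹ = (1 : K[X]) := by rw [← C_mul, mul_inv_cancel₀ hρ, C_1]
    linear_combination (C a * C (ρ ^ Multiset.card s) *
      (Multiset.map (fun a => X - C a) (Multiset.map (fun a => a * ρ⁻¹) s)).prod) * hC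

/-- If `κ` is infinitely large with respect to a valuation, then the reduction of the equation
`p' y - p y' + κ p y = κ x^k (x - 1)^l` is `p y = x^k (x - 1)^l`, and `p` has at most a
`k`-fold zero at the origin. -/
lemma twistedWronskian_ne_of_inv_mem_nonunits {K : Type*} [Field K] [IsAlgClosed K]
    (O : ValuationSubring K) {κ : K} (hκ0 : κ ≠ 0) (hκ : κ⁻¹ ∈ O.nonunits) {q y : K[X]}
    (hq : q.Monic) (hy : y.Monic) (k l : ℕ) :
    twistedWronskian κ (X ^ (k + 1) * q) y ≠ C κ * (X ^ k * (X - 1) ^ l) := by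
  classical
  intro h
  -- The roots need not be integral. Dividing by an element `ρ` of largest valuation makes them so;
  -- including `1` ensures that `δ = ρ⁻¹`, the rescaled second point, is integral too.
  obtain ⟨ρ, hρmem, hρmax⟩ := Finset.exists_max_image (insert 1 (q.roots + y.roots).toFinset)
    O.valuation ⟨1, Finset.mem_insert_self _ _⟩
  have hρ1 : 1 ≤ O.valuation ρ := by
    simpa using hρmax 1 (Finset.mem_insert_self _ _)
  have hρ0 : ρ ≠ 0 := by rintro rfl; simp at hρ1
  have hmem : ∀ a, O.valuation a ≤ O.valuation ρ → a * ρ⁻¹ ∈ O := fun a ha => by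
    rw [← O.valuation_le_one_iff, map_mul, map_inv₀, ← div_eq_mul_inv]
    exact div_le_one_of_le₀ ha zero_le
  have hδ : ρ⁻¹ ∈ O := by simpa using hmem 1 (by simpa using hρ1)
  have hroot : ∀ a ∈ q.roots + y.roots, a * ρ⁻¹ ∈ O := fun a ha =>
    hmem a (hρmax a (Finset.mem_insert_of_mem (Multiset.mem_toFinset.2 ha)))
  have hlift : ∀ s : Multiset K, s ≤ q.roots + y.roots →
      ∃ u : Multiset O, u.map O.subtype = s.map fun a => a * ρ⁻¹ := by
    intro s hs
    have : ∀ b ∈ s.map (fun a => a * ρ⁻¹), b ∈ O := by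
      intro b hb
      obtain ⟨a, ha, rfl⟩ := Multiset.mem_map.1 hb
      exact hroot a (Multiset.mem_of_le hs ha)
    generalize s.map (fun a => a * ρ⁻¹) = u at this
    exact ⟨u.pmap (fun a ha => ⟨a, ha⟩) this, by simp [Multiset.map_pmap, Multiset.pmap_eq_map]⟩
  obtain ⟨uq, huq⟩ := hlift q.roots (Multiset.le_add_right _ _)
  obtain ⟨uy, huy⟩ := hlift y.roots (Multiset.le_add_left _ _)
  have hε := (O.nonunits_le hκ : κ⁻¹ ∈ O)
  -- the rescaled equation over the valuation ring
  set Q : O[X] := (uq.map fun a => X - C a).prod with hQ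
  set Y : O[X] := (uy.map fun a => X - C a).prod with hY
  have hQmap : q.comp (C ρ * X + C 0) = C (ρ ^ q.natDegree) * Q.map O.subtype := by
    rw [comp_C_mul_X_eq hq hρ0, ← huq, hQ, Polynomial.map_multiset_prod, Multiset.map_map,
      Multiset.map_map]
    simp
  have hYmap : y.comp (C ρ * X + C 0) = C (ρ ^ y.natDegree) * Y.map O.subtype := by
    rw [comp_C_mul_X_eq hy hρ0, ← huy, hY, Polynomial.map_multiset_prod, Multiset.map_map,
      Multiset.map_map]
    simp
  have hdeg : (k + 1) + q.natDegree + y.natDegree = k + l := by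
    have h1 := congrArg natDegree h
    have hX1 : (X - 1 : K[X]) = X - C 1 := by simp
    rw [natDegree_twistedWronskian hκ0 ((monic_X_pow _).mul hq).ne_zero hy.ne_zero,
      (monic_X_pow _).natDegree_mul hq, natDegree_C_mul hκ0, hX1,
      (monic_X_pow _).natDegree_mul ((monic_X_sub_C 1).pow _), natDegree_X_pow,
      natDegree_X_pow, natDegree_pow, natDegree_X_sub_C, mul_one] at h1
    exact h1
  set δ : O := ⟨ρ⁻¹, hδ⟩ with hδdef
  set e : O := ⟨κ⁻¹, hε⟩ with hedef
  -- The substitution `x ↦ ρ x`, divided by `κ ρ ρ^(k+l)`; the powers of `ρ` match because the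
  -- degrees of the two sides do. The derivative terms carry the factor `κ⁻¹`, which reduces to
  -- zero.
  have hO : C (e * δ) * (derivative (X ^ (k + 1) * Q) * Y - (X ^ (k + 1) * Q) * derivative Y)
      + X ^ (k + 1) * Q * Y = X ^ k * (X - C δ) ^ l := by
    apply map_injective O.subtype Subtype.val_injective
    have h1 := twistedWronskian_comp_affine κ ρ 0 (X ^ (k + 1) * q) y
    have hX : (X ^ (k + 1) * q).comp (C ρ * X + C 0)
        = C (ρ ^ (k + 1 + q.natDegree)) * (X ^ (k + 1) * Q.map O.subtype) := by
      rw [mul_comp, pow_comp, X_comp, hQmap]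
      simp only [C_0, add_zero, mul_pow, pow_add, C_mul, C_pow]
      ring
    rw [h, hX, hYmap, twistedWronskian_C_mul_left, twistedWronskian_C_mul_right] at h1
    simp only [Polynomial.map_add, Polynomial.map_mul, Polynomial.map_sub, Polynomial.map_pow,
      map_X, map_C, ← derivative_map]
    have e1 : O.subtype δ = ρ⁻¹ := rfl
    have e2 : O.subtype (e * δ) = κ⁻¹ * ρ⁻¹ := rfl
    rw [e1, e2]
    have hC1 : C ρ * C ρ⁻¹ = (1 : K[X]) := by rw [← C_mul, mul_inv_cancel₀ hρ0, C_1]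
    have hC2 : C κ * C κ⁻¹ = (1 : K[X]) := by rw [← C_mul, mul_inv_cancel₀ hκ0, C_1]
    have hX1 : C ρ * X - (1 : K[X]) = C ρ * (X - C ρ⁻¹) := by linear_combination hC1
    have hne : C (κ * ρ * ρ ^ (k + l)) ≠ (0 : K[X]) := by
      rw [Ne, C_eq_zero]; exact mul_ne_zero (mul_ne_zero hκ0 hρ0) (pow_ne_zero _ hρ0)
    apply mul_left_cancel₀ hne
    have hpow : C (ρ ^ (k + l)) = C (ρ ^ (k + 1 + q.natDegree)) * (C (ρ ^ y.natDegree) : K[X]) := by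
      rw [← C_mul, ← pow_add, hdeg]
    simp only [mul_comp, C_comp, pow_comp, X_comp, sub_comp, one_comp, C_0, add_zero] at h1
    rw [hX1, mul_pow, mul_pow] at h1
    have e3 : C ρ * (C κ * (C ρ ^ k * X ^ k * (C ρ ^ l * (X - C ρ⁻¹) ^ l)))
        = C (κ * ρ * ρ ^ (k + l)) * (X ^ k * (X - C ρ⁻¹) ^ l) := by
      simp only [C_mul, C_pow, pow_add]; ring
    rw [e3] at h1
    rw [h1, ← mul_assoc, ← hpow, twistedWronskian]
    simp only [C_mul, derivative_mul]
    have e4 : C κ * C ρ * (C κ⁻¹ * C ρ⁻¹) = (1 : K[X]) := by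
      linear_combination C ρ * C ρ⁻¹ * hC2 + hC1
    linear_combination (C (ρ ^ (k + l)) * ((derivative (X ^ (k + 1)) * map O.subtype Q +
      X ^ (k + 1) * derivative (map O.subtype Q)) * map O.subtype Y
      - X ^ (k + 1) * map O.subtype Q * derivative (map O.subtype Y))) * e4
  -- reduction
  set r := IsLocalRing.residue O with hr
  have hemem : r e = 0 := by
    rw [hr, IsLocalRing.residue_eq_zero_iff]
    obtain ⟨h1, h2⟩ := (ValuationSubring.mem_nonunits_iff_exists_mem_maximalIdeal).1 hκ
    exact h2
  have hred := congrArg (Polynomial.map r) hO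
  simp only [Polynomial.map_add, Polynomial.map_mul, Polynomial.map_sub, Polynomial.map_pow,
      map_X, map_C, map_mul, hemem, zero_mul, C_0, zero_add] at hred
  have hfac : ∀ u : Multiset O, (∃ a ∈ u, r a = 1) →
      (((u.map fun a => X - C a).prod).map r).eval 1 = 0 := by
    rintro u ⟨a, ha, ha1⟩
    rw [Polynomial.map_multiset_prod, eval_multiset_prod, Multiset.map_map, Multiset.map_map]
    refine Multiset.prod_eq_zero (Multiset.mem_map.2 ⟨a, ha, ?_⟩)
    simp [ha1]
  have hone : ∀ (s : Multiset K) (u : Multiset O),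
      u.map O.subtype = s.map (fun a => a * ρ⁻¹) → ρ ∈ s → ∃ a ∈ u, r a = 1 := by
    intro s u hus hs
    have h1 : (1 : K) ∈ u.map O.subtype := by
      rw [hus]; exact Multiset.mem_map.2 ⟨ρ, hs, mul_inv_cancel₀ hρ0⟩
    obtain ⟨a, ha, ha1⟩ := Multiset.mem_map.1 h1
    have : a = 1 := Subtype.ext ha1
    exact ⟨a, ha, by rw [this, map_one]⟩
  -- If `δ` reduces to `0`, then `ρ ≠ 1` is a root of `q` or `y`, rescaled to `1`, so the left side
  -- vanishes at `1` but `x^(k+l)` does not. Otherwise cancel `x^k` and evaluate at `0`.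
  by_cases hrδ : r δ = 0
  · have hρne : ρ ≠ 1 := by
      intro h1
      have : δ = 1 := Subtype.ext (by simp [hδdef, h1])
      rw [this, map_one] at hrδ
      exact one_ne_zero hrδ
    have hρs := Multiset.mem_toFinset.1 (Finset.mem_of_mem_insert_of_ne hρmem hρne)
    have hev := congrArg (eval 1) hred
    rw [hrδ] at hev
    simp only [eval_mul, eval_pow, eval_X, one_pow, C_0, sub_zero, one_mul] at hev
    rcases Multiset.mem_add.1 hρs with hs | hs
    · rw [hQ, hfac uq (hone _ _ huq hs), zero_mul] at hev
      exact zero_ne_one hev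
    · rw [hY, hfac uy (hone _ _ huy hs), mul_zero] at hev
      exact zero_ne_one hev
  · have hev : X * (Q.map r * Y.map r) = (X - C (r δ)) ^ l := by
      apply mul_left_cancel₀ (pow_ne_zero k (X_ne_zero (R := IsLocalRing.ResidueField O)))
      rw [← hred]; ring
    have := congrArg (eval 0) hev
    simp only [eval_mul, eval_X, zero_mul, eval_pow, eval_sub, eval_C, zero_sub] at this
    exact pow_ne_zero l (neg_ne_zero.2 hrδ) this.symm

lemma exists_monic_pi_lift {ι R : Type*} [CommRing R] [Nontrivial R] [Nonempty ι] (f : ι → R[X])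
    (d : ℕ) (hm : ∀ i, (f i).Monic) (hd : ∀ i, (f i).natDegree = d) :
    ∃ F : (ι → R)[X], F.Monic ∧ ∀ i, F.map (Pi.evalRingHom (fun _ => R) i) = f i := by
  set G : (ι → R)[X] := ∑ j ∈ Finset.range d, C (fun i => (f i).coeff j) * X ^ j with hG
  refine ⟨X ^ d + G, ?_, fun i => ?_⟩
  · refine monic_X_pow_add ?_
    rw [hG]
    refine (degree_sum_le _ _).trans_lt ?_
    refine (Finset.sup_lt_iff (WithBot.bot_lt_coe d)).2 fun j hj => ?_
    refine (degree_C_mul_X_pow_le _ _).trans_lt ?_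
    exact WithBot.coe_lt_coe.2 (Finset.mem_range.1 hj)
  · have h1 := (f i).as_sum_range_C_mul_X_pow
    rw [hd i, Finset.sum_range_succ, ← hd i, (hm i).coeff_natDegree, C_1, one_mul, hd i,
      add_comm] at h1
    rw [h1, hG]
    simp [Polynomial.map_sum]

lemma pi_polynomial_ext {ι R : Type*} [CommRing R] {f g : (ι → R)[X]}
    (h : ∀ i, f.map (Pi.evalRingHom (fun _ => R) i) = g.map (Pi.evalRingHom (fun _ => R) i)) :
    f = g := by
  ext n i
  have := congrArg (fun p => p.coeff n) (h i)
  simpa [coeff_map] using this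

/-- The image of `X` is not a unit in the image of `ℂ[X]`, hence lies in a proper ideal, and a
proper ideal of a subring consists of nonunits of some valuation ring. -/
lemma exists_valuationSubring_of_transcendental {K : Type*} [Field K] (φ : ℂ[X] →+* K)
    (hφ : ∀ f, f ≠ 0 → φ f ≠ 0) : ∃ O : ValuationSubring K, φ X ∈ O.nonunits := by
  set x : φ.range := ⟨φ X, X, rfl⟩
  have hI : Ideal.span {x} ≠ ⊤ := by
    rw [Ne, Ideal.span_singleton_eq_top]
    intro hu
    obtain ⟨⟨_, f, rfl⟩, hb⟩ := isUnit_iff_exists_inv.1 hu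
    have h1 : φ (X * f - 1) = 0 := by
      rw [map_sub, map_mul, map_one, sub_eq_zero]
      exact congrArg Subtype.val hb
    refine hφ (X * f - 1) (fun h0 => ?_) h1
    simpa using congrArg (eval 0) h0
  obtain ⟨O, -, hO⟩ := Ideal.image_subset_nonunits_valuationSubring _ hI
  exact ⟨O, hO ⟨x, Ideal.subset_span rfl, rfl⟩⟩

/-- The set of all `κ` for which the equation `p' y - p y' + κ p y = κ x^k (x - 1)^l` has a monic
solution of given degrees such that `p` is divisible by `x^(k+1)`. -/
def exceptionalSet (k l d e : ℕ) : Set ℂ :=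
  {κ | κ ≠ 0 ∧ ∃ q y : ℂ[X], q.Monic ∧ y.Monic ∧ q.natDegree = d ∧ y.natDegree = e ∧
    twistedWronskian κ (X ^ (k + 1) * q) y = C κ * (X ^ k * (X - 1) ^ l)}

lemma exceptionalSet_finite (k l d e : ℕ) : (exceptionalSet k l d e).Finite := by
  by_contra hinf
  set B := exceptionalSet k l d e with hB
  have : Infinite B := Set.infinite_coe_iff.2 hinf
  have hB0 : ∀ b : B, (b : ℂ) ≠ 0 := fun b => b.2.1
  choose q y hq hy hqd hyd heq using fun b : B => b.2.2
  -- The fixed degree lets all solutions be assembled into one solution over the product ring of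
  -- functions on the exceptional set.
  obtain ⟨Q, hQ, hQe⟩ := exists_monic_pi_lift q d hq hqd
  obtain ⟨Y, hY, hYe⟩ := exists_monic_pi_lift y e hy hyd
  set kap : B → ℂ := fun b => b with hkap
  set inv : B → ℂ := fun b => (b : ℂ)⁻¹ with hinv
  have hunit : kap * inv = 1 := funext fun b => mul_inv_cancel₀ (hB0 b)
  have hR : twistedWronskian kap (X ^ (k + 1) * Q) Y = C kap * (X ^ k * (X - 1) ^ l) := by
    refine pi_polynomial_ext fun b => ?_
    rw [twistedWronskian_map, Polynomial.map_mul, hQe, hYe]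
    simpa using heq b
  set g : ℂ[X] →+* (B → ℂ) := (aeval inv).toRingHom with hg
  have hgb : ∀ f b, g f b = f.eval ((b : ℂ)⁻¹) := fun f b => by
    have h1 := aeval_algHom_apply (Pi.evalAlgHom ℂ (fun _ : B => ℂ) b) inv f
    exact h1.symm.trans (by simp [hinv, coe_aeval_eq_eval])
  have hg0 : ∀ f, f ≠ 0 → g f ≠ 0 := by
    intro f hf h0
    refine hf (eq_zero_of_infinite_isRoot f ?_)
    have hinj : Function.Injective inv := fun a b hab => Subtype.ext (inv_injective hab)
    refine (Set.infinite_range_of_injective hinj).mono ?_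
    rintro _ ⟨b, rfl⟩
    exact (hgb f b).symm.trans (congrFun h0 b)
  -- A nonzero polynomial in `κ⁻¹` is not the zero function on an infinite set, so some prime ideal
  -- contains none of them; modulo it, `κ⁻¹` is transcendental over `ℂ`.
  obtain ⟨J, hJ, -, hdisj⟩ := Ideal.exists_le_prime_disjoint (⊥ : Ideal (B → ℂ))
    ((nonZeroDivisors ℂ[X]).map g) (by
      rw [Set.disjoint_left]
      rintro a ha ⟨f, hf, rfl⟩
      exact hg0 f (nonZeroDivisors.ne_zero hf) (by simpa using ha))
  let K := AlgebraicClosure (FractionRing ((B → ℂ) ⧸ J))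
  let ψ : (B → ℂ) →+* K := (algebraMap (FractionRing ((B → ℂ) ⧸ J)) K).comp
    ((algebraMap ((B → ℂ) ⧸ J) (FractionRing ((B → ℂ) ⧸ J))).comp (Ideal.Quotient.mk J))
  have hψ : ∀ a, ψ a = 0 → a ∈ J := by
    intro a ha
    have h1 := (map_eq_zero_iff _ (FaithfulSMul.algebraMap_injective
      (FractionRing ((B → ℂ) ⧸ J)) K)).1 ha
    have h2 := (map_eq_zero_iff _ (IsFractionRing.injective ((B → ℂ) ⧸ J)
      (FractionRing ((B → ℂ) ⧸ J)))).1 h1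
    exact Ideal.Quotient.eq_zero_iff_mem.1 h2
  obtain ⟨O, hO⟩ := exists_valuationSubring_of_transcendental (ψ.comp g) (fun f hf h0 => by
    refine Set.disjoint_left.1 hdisj (hψ _ h0) ⟨f, ?_, rfl⟩
    exact mem_nonZeroDivisors_of_ne_zero hf)
  have hgX : g X = inv := by simp [hg]
  have hmul : ψ kap * ψ inv = 1 := by rw [← map_mul, hunit, map_one]
  have hinvK : ψ inv = (ψ kap)⁻¹ := eq_inv_of_mul_eq_one_right hmul
  rw [RingHom.comp_apply, hgX, hinvK] at hO
  refine twistedWronskian_ne_of_inv_mem_nonunits O (left_ne_zero_of_mul_eq_one hmul) hO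
    (hQ.map ψ) (hY.map ψ) k l ?_
  have := congrArg (Polynomial.map ψ) hR
  rw [twistedWronskian_map] at this
  simpa using this

/-- The substitution `x ↦ (b - a) x + a` moves the two points to `0` and `1` and multiplies `κ` by
`b - a`. After making both factors monic, leading coefficients determine the constant on the right,
and degrees leave finitely many exceptional sets. -/
lemma finite_setOf_pow_succ_dvd (k l : ℕ) : ∃ S : Set ℂ, S.Finite ∧
    ∀ (κ a b c : ℂ) (p y : ℂ[X]), κ ≠ 0 → a ≠ b → c ≠ 0 →
      twistedWronskian κ p y = C c * ((X - C a) ^ k * (X - C b) ^ l) →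
      (X - C a) ^ (k + 1) ∣ p → κ * (b - a) ∈ S := by
  refine ⟨⋃ d ∈ Finset.range (k + l + 1), ⋃ e ∈ Finset.range (k + l + 1),
    exceptionalSet k l d e, ?_, ?_⟩
  · exact Set.Finite.biUnion (Finset.finite_toSet _) fun d _ =>
      Set.Finite.biUnion (Finset.finite_toSet _) fun e _ => exceptionalSet_finite k l d e
  intro κ a b c p y hκ hab hc h hdvd
  have hT : (C c * ((X - C a) ^ k * (X - C b) ^ l) : ℂ[X]) ≠ 0 :=
    mul_ne_zero (C_ne_zero.2 hc) (mul_ne_zero (pow_ne_zero _ (X_sub_C_ne_zero a))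
      (pow_ne_zero _ (X_sub_C_ne_zero b)))
  have hp : p ≠ 0 := by rintro rfl; rw [← h] at hT; simp [twistedWronskian] at hT
  have hy : y ≠ 0 := by rintro rfl; rw [← h] at hT; simp [twistedWronskian] at hT
  have hba : b - a ≠ 0 := sub_ne_zero.2 hab.symm
  have hcomp := twistedWronskian_comp_affine κ (b - a) a p y
  obtain ⟨q, rfl⟩ := hdvd
  set r : ℂ[X] := C (b - a) * X + C a with hr
  have hrd : r.natDegree = 1 := natDegree_linear hba
  have hr0 : ∀ f : ℂ[X], f ≠ 0 → f.comp r ≠ 0 := fun f hf h0 => by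
    rcases comp_eq_zero_iff.1 h0 with h1 | ⟨-, h1⟩
    · exact hf h1
    · rw [h1, natDegree_C] at hrd; exact zero_ne_one hrd
  have hXa : (X - C a).comp r = C (b - a) * X := by simp [hr]
  have hXb : (X - C b).comp r = C (b - a) * (X - 1) := by
    simp only [hr, sub_comp, X_comp, C_comp, C_sub]; ring
  rw [h] at hcomp
  simp only [mul_comp, pow_comp, hXa, hXb, C_comp] at hcomp
  set Q := q.comp r with hQ
  set Y := y.comp r with hY
  have hQ0 : Q ≠ 0 := hr0 q (right_ne_zero_of_mul hp)
  have hY0 : Y ≠ 0 := hr0 y hy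
  have hQl := leadingCoeff_ne_zero.2 hQ0
  have hYl := leadingCoeff_ne_zero.2 hY0
  have hκ' : κ * (b - a) ≠ 0 := mul_ne_zero hκ hba
  have hQm : (C Q.leadingCoeff⁻¹ * Q).Monic := by
    rw [Monic, leadingCoeff_mul, leadingCoeff_C, inv_mul_cancel₀ hQl]
  have hYm : (C Y.leadingCoeff⁻¹ * Y).Monic := by
    rw [Monic, leadingCoeff_mul, leadingCoeff_C, inv_mul_cancel₀ hYl]
  have hX1 : (X - 1 : ℂ[X]) = X - C 1 := by simp
  have hM : (X ^ k * (X - 1) ^ l : ℂ[X]).Monic := by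
    rw [hX1]; exact (monic_X_pow k).mul ((monic_X_sub_C 1).pow l)
  have hMd : (X ^ k * (X - 1) ^ l : ℂ[X]).natDegree = k + l := by
    rw [hX1, (monic_X_pow k).natDegree_mul ((monic_X_sub_C 1).pow l), natDegree_X_pow,
      natDegree_pow, natDegree_X_sub_C, mul_one]
  have hmain : twistedWronskian (κ * (b - a)) (X ^ (k + 1) * (C Q.leadingCoeff⁻¹ * Q))
      (C Y.leadingCoeff⁻¹ * Y) = C (κ * (b - a)) * (X ^ k * (X - 1) ^ l) := by
    have h1 : ∃ c', twistedWronskian (κ * (b - a)) (X ^ (k + 1) * (C Q.leadingCoeff⁻¹ * Q))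
        (C Y.leadingCoeff⁻¹ * Y) = C c' * (X ^ k * (X - 1) ^ l) := by
      have e1 : (C (b - a) * X) ^ (k + 1) * Q = C ((b - a) ^ (k + 1)) * (X ^ (k + 1) * Q) := by
        rw [mul_pow, C_pow]; ring
      rw [e1, twistedWronskian_C_mul_left] at hcomp
      have e2 : X ^ (k + 1) * (C Q.leadingCoeff⁻¹ * Q) = C Q.leadingCoeff⁻¹ * (X ^ (k + 1) * Q) := by
        ring
      have e3 : C ((b - a) ^ (k + 1))⁻¹ * C ((b - a) ^ (k + 1)) = (1 : ℂ[X]) := by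
        rw [← C_mul, inv_mul_cancel₀ (pow_ne_zero _ hba), C_1]
      refine ⟨Q.leadingCoeff⁻¹ * Y.leadingCoeff⁻¹ * ((b - a) ^ (k + 1))⁻¹ * (b - a) * c
        * (b - a) ^ k * (b - a) ^ l, ?_⟩
      rw [e2, twistedWronskian_C_mul_left, twistedWronskian_C_mul_right]
      simp only [C_mul, C_pow, mul_pow] at hcomp e3 ⊢
      linear_combination (-C Q.leadingCoeff⁻¹ * C Y.leadingCoeff⁻¹ * C ((b - a) ^ (k + 1))⁻¹)
        * hcomp - (C Q.leadingCoeff⁻¹ * C Y.leadingCoeff⁻¹ *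
          twistedWronskian (κ * (b - a)) (X ^ (k + 1) * Q) Y) * e3
    obtain ⟨c', hc'⟩ := h1
    have h2 := congrArg leadingCoeff hc'
    rw [leadingCoeff_twistedWronskian hκ' ((monic_X_pow _).mul hQm).ne_zero hYm.ne_zero,
      ((monic_X_pow _).mul hQm).leadingCoeff, hYm.leadingCoeff, leadingCoeff_mul, leadingCoeff_C,
      hM.leadingCoeff] at h2
    rw [hc', show c' = κ * (b - a) by linear_combination -h2]
  have hdeg := congrArg natDegree hmain
  rw [natDegree_twistedWronskian hκ' ((monic_X_pow _).mul hQm).ne_zero hYm.ne_zero,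
    (monic_X_pow _).natDegree_mul hQm, natDegree_C_mul hκ', natDegree_X_pow, hMd] at hdeg
  exact Set.mem_biUnion (Finset.mem_range.2 (by omega)) (Set.mem_biUnion
    (Finset.mem_range.2 (by omega)) ⟨hκ', _, _, hQm, hYm, rfl, rfl, hmain⟩)

/-! ### Spaces of quasi-exponentials. -/

section QuasiSpan

lemma mem_quasiSpan_iff {mu : Fin 2 → ℂ} {p : Fin 2 → ℂ[X]} {f : ℂ → ℂ} :
    f ∈ quasiSpan mu p ↔
      ∃ c : Fin 2 → ℂ, f = fun x => ∑ i, c i * ((p i).eval x * Complex.exp (mu i * x)) := by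
  rw [quasiSpan, Submodule.mem_span_range_iff_exists_fun]
  refine exists_congr fun c => ?_
  rw [eq_comm]
  have : ∑ i, c i • (fun x : ℂ => (p i).eval x * Complex.exp (mu i * x))
      = fun x => ∑ i, c i * ((p i).eval x * Complex.exp (mu i * x)) := by
    ext x; simp
  rw [this]

lemma quasi_mem_quasiSpan (mu : Fin 2 → ℂ) (p : Fin 2 → ℂ[X]) (i : Fin 2) :
    (fun x => (p i).eval x * Complex.exp (mu i * x)) ∈ quasiSpan mu p :=
  Submodule.subset_span ⟨i, rfl⟩

lemma hasDerivAt_eval_mul_exp (p : ℂ[X]) (ν x : ℂ) :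
    HasDerivAt (fun x => p.eval x * Complex.exp (ν * x))
      ((derivative p + C ν * p).eval x * Complex.exp (ν * x)) x := by
  have h1 : HasDerivAt (fun x => Complex.exp (ν * x)) (Complex.exp (ν * x) * ν) x := by
    simpa using ((hasDerivAt_id x).const_mul ν).cexp
  refine ((p.hasDerivAt x).mul h1).congr_deriv ?_
  simp only [eval_add, eval_mul, eval_C]; ring

/-- Differentiation replaces `p` by `p' + κ p` and lowers the degree of `q`; and `p' + κ p = W_κ(p,
1)` vanishes only for `p = 0`. -/
lemma eq_zero_of_eval_mul_exp_eq {κ : ℂ} (hκ : κ ≠ 0) {p q : ℂ[X]}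
    (h : ∀ x, p.eval x * Complex.exp (κ * x) = q.eval x) : p = 0 := by
  suffices H : ∀ n : ℕ, ∀ p q : ℂ[X], q.degree < n →
      (∀ x, p.eval x * Complex.exp (κ * x) = q.eval x) → p = 0 from
    H (q.natDegree + 1) p q
      (degree_le_natDegree.trans_lt (by exact_mod_cast Nat.lt_succ_self _)) h
  intro n
  induction n with
  | zero =>
    intro p q hq h
    have h0 : q = 0 := by simpa using hq
    refine Polynomial.funext fun x => ?_
    simpa [h0, Complex.exp_ne_zero] using h x
  | succ n ih =>
    intro p q hq h
    have hd : (derivative q).degree < n := by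
      rcases eq_or_ne q 0 with rfl | hs0
      · simp [bot_lt_iff_ne_bot]
      · refine (degree_derivative_lt hs0).trans_le ?_
        rw [degree_eq_natDegree hs0] at hq ⊢
        exact_mod_cast Nat.lt_succ_iff.1 (by exact_mod_cast hq)
    have h1 := ih (derivative p + C κ * p) (derivative q) hd fun x => by
      have e1 := hasDerivAt_eval_mul_exp p κ x
      rw [funext h] at e1
      exact e1.unique (q.hasDerivAt x)
    by_contra hp
    refine twistedWronskian_ne_zero hκ hp one_ne_zero ?_
    simpa [twistedWronskian] using h1

lemma eq_zero_of_sum_quasi_eq_zero {mu : Fin 2 → ℂ} (hmu : mu 0 ≠ mu 1) {p : Fin 2 → ℂ[X]}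
    (h : ∀ x, ∑ i, (p i).eval x * Complex.exp (mu i * x) = 0) (i : Fin 2) : p i = 0 := by
  have key : ∀ i j : Fin 2, mu i ≠ mu j →
      (∀ x, (p i).eval x * Complex.exp (mu i * x) + (p j).eval x * Complex.exp (mu j * x) = 0) →
      p i = 0 := by
    intro i j hij h
    refine eq_zero_of_eval_mul_exp_eq (sub_ne_zero.2 hij) (q := -p j) fun x => ?_
    have h1 := Complex.exp_ne_zero (mu j * x)
    apply mul_right_cancel₀ h1
    rw [mul_assoc, ← Complex.exp_add, eval_neg]
    have e : (mu i - mu j) * x + mu j * x = mu i * x := by ring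
    rw [e]
    linear_combination h x
  simp only [Fin.sum_univ_two] at h
  fin_cases i
  · exact key 0 1 hmu h
  · exact key 1 0 hmu.symm fun x => by rw [add_comm]; exact h x

/-- Distinct exponents make the polynomial coefficients unique up to scalars, so it suffices to
treat one choice of generators of `V` and `U`. -/
lemma exists_eq_C_mul_of_quasiSpan_eq {mu : Fin 2 → ℂ} (hmu : mu 0 ≠ mu 1) {p q : Fin 2 → ℂ[X]}
    (hq : ∀ i, q i ≠ 0) (h : quasiSpan mu p = quasiSpan mu q) (i : Fin 2) :
    ∃ c : ℂ, c ≠ 0 ∧ p i = C c * q i := by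
  have h1 := quasi_mem_quasiSpan mu q i
  rw [← h, mem_quasiSpan_iff] at h1
  obtain ⟨c, hc⟩ := h1
  have h2 := eq_zero_of_sum_quasi_eq_zero hmu
    (p := fun j => C (c j) * p j - C (if j = i then 1 else 0) * q j) (fun x => by
      have := congrFun hc x
      simp only [eval_sub, eval_mul, eval_C, sub_mul, Finset.sum_sub_distrib, ite_mul, one_mul,
        zero_mul, Finset.sum_ite_eq', Finset.mem_univ, if_true]
      rw [sub_eq_zero, this]
      exact Finset.sum_congr rfl fun j _ => by ring) i
  simp only [if_true, C_1, one_mul] at h2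
  have h3 := sub_eq_zero.1 h2
  have hci : c i ≠ 0 := by
    intro h0
    rw [h0, C_0, zero_mul] at h3
    exact hq i h3.symm
  refine ⟨(c i)⁻¹, inv_ne_zero hci, ?_⟩
  rw [← h3, ← mul_assoc, ← C_mul, inv_mul_cancel₀ hci, C_1, one_mul]

end QuasiSpan

/-! ### The factorized second order operator on quasi-exponentials. -/

section Operator

variable {k : ℕ} {mu z : Fin 2 → ℂ} {m : Fin 2 → ℕ} {t : Fin k → ℂ}

lemma eval_fusionPoly_ne_zero_of_ne {x : ℂ} (hx : ∀ a, x ≠ z a) : (fusionPoly z m).eval x ≠ 0 :=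
  eval_fusionPoly_ne_zero.2 fun a _ => hx a

lemma eval_prod_X_sub_C_ne_zero {x : ℂ} (hx : ∀ j, x ≠ t j) :
    (∏ j, (X - C (t j))).eval x ≠ 0 := by
  rw [eval_prod]
  exact Finset.prod_ne_zero_iff.2 fun j _ => by simpa using sub_ne_zero.2 (hx j)

lemma logDeriv_eval_mul_exp {y : ℂ[X]} {x : ℂ} (hy : y.eval x ≠ 0) (ν : ℂ) :
    logDeriv (fun x => y.eval x * Complex.exp (ν * x)) x
      = (derivative y).eval x / y.eval x + ν := by
  rw [logDeriv_apply, (hasDerivAt_eval_mul_exp y ν x).deriv]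
  have := Complex.exp_ne_zero (ν * x)
  simp only [eval_add, eval_mul, eval_C]
  field_simp

lemma logDeriv_exp_mul_eval_div_eval {y T : ℂ[X]} {x : ℂ} (hy : y.eval x ≠ 0)
    (hT : T.eval x ≠ 0) (ν : ℂ) :
    logDeriv (fun x => Complex.exp (ν * x) * T.eval x / y.eval x) x
      = ν + (derivative T).eval x / T.eval x - (derivative y).eval x / y.eval x := by
  have h1 : HasDerivAt (fun x => Complex.exp (ν * x)) (Complex.exp (ν * x) * ν) x := by
    simpa using ((hasDerivAt_id x).const_mul ν).cexp
  have h2 := (h1.mul (T.hasDerivAt x)).div (y.hasDerivAt x) hy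
  have h3 := h2.deriv
  simp only [Pi.mul_def, Pi.div_def] at h3
  rw [logDeriv_apply, h3]
  have := Complex.exp_ne_zero (ν * x)
  field_simp

/-- Each first order factor acts on the polynomial part as a twisted Wronskian, first with `y` and
then with `T`, up to dividing by these polynomials. -/
lemma criticalPointOp_sum_quasi (nu c : Fin 2 → ℂ) (p : Fin 2 → ℂ[X]) {x : ℂ}
    (hz : ∀ a, x ≠ z a) (ht : ∀ j, x ≠ t j) :
    criticalPointOp mu z m t
        (fun x => ∑ i, c i * ((p i).eval x * Complex.exp (nu i * x))) x
      = ∑ i, c i * ((twistedWronskian (nu i - mu 0)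
          (twistedWronskian (nu i - mu 1) (p i) (∏ j, (X - C (t j)))) (fusionPoly z m)).eval x
          / ((∏ j, (X - C (t j))).eval x * (fusionPoly z m).eval x) * Complex.exp (nu i * x)) := by
  set y : ℂ[X] := ∏ j, (X - C (t j)) with hy
  set T := fusionPoly z m with hT
  have hy0 : y.eval x ≠ 0 := eval_prod_X_sub_C_ne_zero ht
  have hT0 : T.eval x ≠ 0 := eval_fusionPoly_ne_zero_of_ne hz
  have eg1 : (fun x => (∏ j, (x - t j)) * Complex.exp (mu 1 * x))
      = fun x => y.eval x * Complex.exp (mu 1 * x) := by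
    ext x; simp [hy, eval_prod]
  have eg2 : (fun x => Complex.exp (mu 0 * x) * (∏ a, (x - z a) ^ m a) / ∏ j, (x - t j))
      = fun x => Complex.exp (mu 0 * x) * T.eval x / y.eval x := by
    ext x; simp [hy, eval_prod, hT, eval_fusionPoly]
  have hder : ∀ x, HasDerivAt (fun x => ∑ i, c i * ((p i).eval x * Complex.exp (nu i * x)))
      (∑ i, c i * ((derivative (p i) + C (nu i) * p i).eval x * Complex.exp (nu i * x))) x :=
    fun x => HasDerivAt.fun_sum fun i _ => (hasDerivAt_eval_mul_exp (p i) (nu i) x).const_mul (c i)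
  set W : Fin 2 → ℂ[X] := fun i => twistedWronskian (nu i - mu 1) (p i) y with hW
  have hin : ∀ x, y.eval x ≠ 0 → firstOrderOp (fun x => y.eval x * Complex.exp (mu 1 * x))
      (fun x => ∑ i, c i * ((p i).eval x * Complex.exp (nu i * x))) x
      = ∑ i, c i * (((W i).eval x * Complex.exp (nu i * x)) / y.eval x) := by
    intro x hx
    rw [firstOrderOp, (hder x).deriv, logDeriv_eval_mul_exp hx, Finset.mul_sum,
      ← Finset.sum_sub_distrib]
    refine Finset.sum_congr rfl fun i _ => ?_
    simp only [hW, twistedWronskian, eval_add, eval_sub, eval_mul, eval_C]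
    field_simp
    ring
  have hev : firstOrderOp (fun x => y.eval x * Complex.exp (mu 1 * x))
      (fun x => ∑ i, c i * ((p i).eval x * Complex.exp (nu i * x)))
      =ᶠ[nhds x] fun x => ∑ i, c i * (((W i).eval x * Complex.exp (nu i * x)) / y.eval x) := by
    filter_upwards [y.continuous.continuousAt.eventually_ne hy0] with x hx using hin x hx
  have hder2 : HasDerivAt
      (fun x => ∑ i, c i * (((W i).eval x * Complex.exp (nu i * x)) / y.eval x))
      (∑ i, c i * ((((derivative (W i) + C (nu i) * W i).eval x * Complex.exp (nu i * x)) * y.eval x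
        - ((W i).eval x * Complex.exp (nu i * x)) * (derivative y).eval x) / y.eval x ^ 2)) x :=
    HasDerivAt.fun_sum fun i _ =>
      ((hasDerivAt_eval_mul_exp (W i) (nu i) x).div (y.hasDerivAt x) hy0).const_mul (c i)
  rw [criticalPointOp, eg1, eg2, firstOrderOp, hev.deriv_eq, hder2.deriv, hin x hy0,
    logDeriv_exp_mul_eval_div_eval hy0 hT0, Finset.mul_sum, ← Finset.sum_sub_distrib]
  refine Finset.sum_congr rfl fun i _ => ?_
  have : twistedWronskian (nu i - mu 1) (p i) y = W i := rfl
  rw [this]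
  simp only [twistedWronskian, eval_add, eval_sub, eval_mul, eval_C]
  field_simp
  ring

lemma twistedWronskian_eq_zero_of_criticalPointOp (nu : Fin 2 → ℂ) (p : Fin 2 → ℂ[X])
    (h : ∀ f ∈ quasiSpan nu p, ∀ x, (∀ a, x ≠ z a) → (∀ j, x ≠ t j) →
      criticalPointOp mu z m t f x = 0) (i : Fin 2) :
    twistedWronskian (nu i - mu 0)
      (twistedWronskian (nu i - mu 1) (p i) (∏ j, (X - C (t j)))) (fusionPoly z m) = 0 := by
  refine eq_zero_of_infinite_isRoot _ (Set.Infinite.mono (s := (Set.range z ∪ Set.range t)ᶜ) ?_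
    ((Set.finite_range z).union (Set.finite_range t)).infinite_compl)
  intro x hx
  simp only [Set.mem_compl_iff, Set.mem_union, Set.mem_range, not_or, not_exists] at hx
  have hz : ∀ a, x ≠ z a := fun a => (hx.1 a ∘ Eq.symm)
  have ht : ∀ j, x ≠ t j := fun j => (hx.2 j ∘ Eq.symm)
  have h1 := h _ (mem_quasiSpan_iff.2 ⟨Pi.single i 1, rfl⟩) x hz ht
  rw [criticalPointOp_sum_quasi nu _ p hz ht, Finset.sum_eq_single i] at h1
  · have h2 := eval_prod_X_sub_C_ne_zero ht
    have h3 := eval_fusionPoly_ne_zero_of_ne (m := m) hz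
    simpa [h2, h3, Complex.exp_ne_zero] using h1
  · intro j _ hj; simp [Pi.single_eq_of_ne hj]
  · simp

end Operator

/-! ### Exponents read off from the Wronskian. -/

section Exponents

/-- The derivative of `f / g` is the Wronskian over `g²`, of order `k`; since `f / g` vanishes at
`x`, its order is `k + 1`. -/
lemma analyticOrderAt_eq_of_wronskian {f g w : ℂ → ℂ} {x : ℂ} {k : ℕ} (hf : AnalyticAt ℂ f x)
    (hg : AnalyticAt ℂ g x) (hw : AnalyticAt ℂ w x) (hfx : f x = 0) (hgx : g x ≠ 0)
    (hwx : w x ≠ 0) (h : ∀ s, deriv f s * g s - f s * deriv g s = (s - x) ^ k * w s) :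
    analyticOrderAt f x = (k + 1 : ℕ) := by
  have hF : AnalyticAt ℂ (fun s => f s / g s) x := hf.fun_div hg hgx
  have hd : analyticOrderAt (deriv fun s => f s / g s) x = k := by
    rw [hF.deriv.analyticOrderAt_eq_natCast]
    refine ⟨fun s => w s / g s ^ 2, hw.fun_div (hg.fun_pow 2) (pow_ne_zero 2 hgx),
      div_ne_zero hwx (pow_ne_zero 2 hgx), ?_⟩
    filter_upwards [hf.eventually_analyticAt, hg.eventually_analyticAt,
      hg.continuousAt.eventually_ne hgx] with s h1 h2 h3
    have := (h1.differentiableAt.hasDerivAt.div h2.differentiableAt.hasDerivAt h3).deriv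
    simp only [Pi.div_def] at this
    rw [this, h s, smul_eq_mul]
    ring
  have h1 := hF.analyticOrderAt_deriv_add_one
  rw [hd, hfx, zero_div] at h1
  simp only [sub_zero] at h1
  have h2 : f =ᶠ[nhds x] (fun s => f s / g s) * g := by
    filter_upwards [hg.continuousAt.eventually_ne hgx] with s hs
    simp [hs]
  rw [analyticOrderAt_congr h2, analyticOrderAt_mul hF hg, hg.analyticOrderAt_eq_zero.2 hgx,
    ← h1, add_zero]
  push_cast; rfl

lemma analyticAt_sum_quasi (lam d : Fin 2 → ℂ) (p : Fin 2 → ℂ[X]) (x : ℂ) :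
    AnalyticAt ℂ (fun s => ∑ i, d i * ((p i).eval s * Complex.exp (lam i * s))) x :=
  Differentiable.analyticAt (fun s => (HasDerivAt.fun_sum fun i _ =>
    (hasDerivAt_eval_mul_exp (p i) (lam i) s).const_mul (d i)).differentiableAt) x

lemma deriv_mul_sub_mul_deriv_sum_quasi (lam d e : Fin 2 → ℂ) (p : Fin 2 → ℂ[X]) (s : ℂ) :
    deriv (fun s => ∑ i, d i * ((p i).eval s * Complex.exp (lam i * s))) s
          * ∑ i, e i * ((p i).eval s * Complex.exp (lam i * s))
        - (∑ i, d i * ((p i).eval s * Complex.exp (lam i * s)))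
          * deriv (fun s => ∑ i, e i * ((p i).eval s * Complex.exp (lam i * s))) s
      = (d 0 * e 1 - d 1 * e 0) * (twistedWronskian (lam 0 - lam 1) (p 0) (p 1)).eval s
        * Complex.exp ((lam 0 + lam 1) * s) := by
  have hder : ∀ c : Fin 2 → ℂ, HasDerivAt
      (fun s => ∑ i, c i * ((p i).eval s * Complex.exp (lam i * s)))
      (∑ i, c i * ((derivative (p i) + C (lam i) * p i).eval s * Complex.exp (lam i * s))) s :=
    fun c => HasDerivAt.fun_sum fun i _ =>
      (hasDerivAt_eval_mul_exp (p i) (lam i) s).const_mul (c i)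
  rw [(hder d).deriv, (hder e).deriv, add_mul, Complex.exp_add]
  simp only [twistedWronskian, eval_add, eval_sub, eval_mul, eval_C, Fin.sum_univ_two]
  ring

lemma analyticOrderAt_sum_quasi {lam d e : Fin 2 → ℂ} {p : Fin 2 → ℂ[X]} {c x : ℂ} {k : ℕ}
    {T : ℂ[X]} (hc : c ≠ 0)
    (h : twistedWronskian (lam 0 - lam 1) (p 0) (p 1) = C c * ((X - C x) ^ k * T))
    (hT : T.eval x ≠ 0) (hde : d 0 * e 1 - d 1 * e 0 ≠ 0)
    (hd : ∑ i, d i * ((p i).eval x * Complex.exp (lam i * x)) = 0)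
    (he : ∑ i, e i * ((p i).eval x * Complex.exp (lam i * x)) ≠ 0) :
    analyticOrderAt (fun s => ∑ i, d i * ((p i).eval s * Complex.exp (lam i * s))) x
      = (k + 1 : ℕ) := by
  refine analyticOrderAt_eq_of_wronskian (analyticAt_sum_quasi lam d p x)
    (analyticAt_sum_quasi lam e p x) (w := fun s =>
      (d 0 * e 1 - d 1 * e 0) * c * T.eval s * Complex.exp ((lam 0 + lam 1) * s)) ?_ hd he ?_ ?_
  · exact (analyticAt_const.mul (T.differentiable.analyticAt x)).mul (by fun_prop)
  · exact mul_ne_zero (mul_ne_zero (mul_ne_zero hde hc) hT) (Complex.exp_ne_zero _)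
  · intro s
    rw [deriv_mul_sub_mul_deriv_sum_quasi, h]
    simp only [eval_mul, eval_C, eval_pow, eval_sub, eval_X]
    ring

lemma exponents_quasiSpan {lam : Fin 2 → ℂ} {p : Fin 2 → ℂ[X]} {c x : ℂ} {k : ℕ} {T : ℂ[X]}
    (hc : c ≠ 0)
    (h : twistedWronskian (lam 0 - lam 1) (p 0) (p 1) = C c * ((X - C x) ^ k * T))
    (hT : T.eval x ≠ 0) (hx : ∃ i, (p i).eval x ≠ 0) :
    exponents (quasiSpan lam p) x = {0, 1 + (k : ℤ)} := by
  set F : (Fin 2 → ℂ) → ℂ → ℂ :=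
    fun c s => ∑ i, c i * ((p i).eval s * Complex.exp (lam i * s)) with hF
  have han : ∀ c s, AnalyticAt ℂ (F c) s := fun c s => analyticAt_sum_quasi lam c p s
  have hord : ∀ c, meromorphicOrderAt (F c) x = (analyticOrderAt (F c) x).map (↑) :=
    fun c => (han c x).meromorphicOrderAt_eq
  obtain ⟨i, hi⟩ := hx
  set e : Fin 2 → ℂ := Pi.single i 1 with he
  have hFe : ∀ s, F e s = (p i).eval s * Complex.exp (lam i * s) := by
    intro s
    simp only [hF]
    rw [Finset.sum_eq_single i]
    · simp [he]
    · intro j _ hj; simp [he, Pi.single_eq_of_ne hj]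
    · simp
  have hFex : F e x ≠ 0 := by rw [hFe]; exact mul_ne_zero hi (Complex.exp_ne_zero _)
  have hmain : ∀ d : Fin 2 → ℂ, d 0 * e 1 - d 1 * e 0 ≠ 0 → F d x = 0 →
      analyticOrderAt (F d) x = (k + 1 : ℕ) :=
    fun d hd hdx => analyticOrderAt_sum_quasi hc h hT hd hdx hFex
  ext o
  simp only [exponents, Set.mem_ofPred_eq, Set.mem_insert_iff, Set.mem_singleton_iff]
  constructor
  · rintro ⟨f, hf, ho⟩
    obtain ⟨d, rfl⟩ := mem_quasiSpan_iff.1 hf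
    change meromorphicOrderAt (F d) x = _ at ho
    rw [hord] at ho
    by_cases hdx : F d x = 0
    · right
      -- A combination proportional to `e` that vanishes at `x` is identically zero, so its order is
      -- `⊤` and not an integer.
      have hdet : d 0 * e 1 - d 1 * e 0 ≠ 0 := by
        intro h0
        have hde : d = fun j => d i * e j := by
          ext j
          fin_cases i <;> fin_cases j <;> simp [he] at h0 ⊢
          · exact h0
          · exact h0
        have hFd : ∀ s, F d s = d i * F e s := by
          intro s
          rw [hde]
          simp only [hF, Finset.mul_sum, he, Pi.single_eq_same, mul_one]
          exact Finset.sum_congr rfl fun j _ => by ring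
        rw [hFd] at hdx
        have hdi := (mul_eq_zero.1 hdx).resolve_right hFex
        have hF0 : F d = 0 := by ext s; rw [hFd, hdi, zero_mul]; rfl
        have : analyticOrderAt (F d) x = ⊤ := by
          rw [analyticOrderAt_eq_top, hF0]; exact .of_forall fun _ => rfl
        rw [this] at ho
        exact WithTop.top_ne_coe ho
      rw [hmain d hdet hdx] at ho
      have : ((k + 1 : ℕ) : ℤ) = o := WithTop.coe_injective ho
      rw [← this]; push_cast; ring
    · left
      rw [(han d x).analyticOrderAt_eq_zero.2 hdx] at ho
      exact (WithTop.coe_injective ho : (0 : ℤ) = o).symm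
  · rintro (rfl | rfl)
    · refine ⟨F e, mem_quasiSpan_iff.2 ⟨e, rfl⟩, ?_⟩
      rw [hord, (han e x).analyticOrderAt_eq_zero.2 hFex]; rfl
    · set d : Fin 2 → ℂ := ![(p 1).eval x * Complex.exp (lam 1 * x),
        -((p 0).eval x * Complex.exp (lam 0 * x))] with hd
      refine ⟨F d, mem_quasiSpan_iff.2 ⟨d, rfl⟩, ?_⟩
      rw [hord, hmain d]
      · have : (1 + (k : ℤ)) = ((k + 1 : ℕ) : ℤ) := by push_cast; ring
        rw [this]; rfl
      · rw [hFe] at hFex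
        fin_cases i
        · simpa [hd, he] using hFex
        · simpa [hd, he] using hFex
      · simp only [hF, hd, Fin.sum_univ_two, Matrix.cons_val_zero, Matrix.cons_val_one]
        ring

end Exponents

/-! ### Partial fractions and the residue theorem for rational functions. -/

section PartialFractions

variable {a b : ℂ} {k l : ℕ}

lemma exists_partial_fractions (hab : a ≠ b) {A : ℂ[X]} (hA : A.natDegree ≤ k + l + 1) :
    ∃ B B' : ℂ[X], B.natDegree ≤ k ∧ B'.natDegree ≤ l ∧
      A = B * (X - C b) ^ (l + 1) + B' * (X - C a) ^ (k + 1) := by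
  set P : ℂ[X] := (X - C a) ^ (k + 1) with hP
  set Q : ℂ[X] := (X - C b) ^ (l + 1) with hQ
  have hPm : P.Monic := (monic_X_sub_C a).pow _
  have hQm : Q.Monic := (monic_X_sub_C b).pow _
  have hPd : P.natDegree = k + 1 := by rw [hP, natDegree_pow, natDegree_X_sub_C, mul_one]
  have hQd : Q.natDegree = l + 1 := by rw [hQ, natDegree_pow, natDegree_X_sub_C, mul_one]
  obtain ⟨u, v, huv⟩ : IsCoprime P Q :=
    (isCoprime_X_sub_C_of_isUnit_sub (sub_ne_zero.2 hab).isUnit).pow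
  have hdiv := modByMonic_add_div (A * v) P
  have hB : ((A * v) %ₘ P).natDegree ≤ k := by
    have := natDegree_modByMonic_lt (A * v) hPm (by
      intro h1; rw [h1, natDegree_one] at hPd; omega)
    omega
  have hsum : A = ((A * v) %ₘ P) * Q + (A * u + (A * v /ₘ P) * Q) * P := by
    linear_combination (-A) * huv - Q * hdiv
  refine ⟨(A * v) %ₘ P, A * u + (A * v /ₘ P) * Q, hB, ?_, hsum⟩
  set B := (A * v) %ₘ P
  set B' := A * u + (A * v /ₘ P) * Q
  rcases eq_or_ne B' 0 with h0 | h0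
  · rw [h0]; simp
  have h1 : (B' * P).natDegree ≤ k + l + 1 := by
    have : B' * P = A - B * Q := by linear_combination -hsum
    rw [this]
    refine (natDegree_sub_le _ _).trans (max_le hA (natDegree_mul_le.trans ?_))
    omega
  rw [mul_comm, hPm.natDegree_mul' h0, hPd] at h1
  omega

lemma coeff_taylor_of_natDegree_le {R : ℂ[X]} {s : ℂ} {n : ℕ} (h : R.natDegree ≤ n) :
    (taylor s R).coeff n = R.coeff n := by
  rcases h.lt_or_eq with h | h
  · rw [coeff_eq_zero_of_natDegree_lt h, coeff_eq_zero_of_natDegree_lt (by rwa [natDegree_taylor])]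
  · rw [← h, coeff_taylor_natDegree, coeff_natDegree]

/-- The sum of the residues at `a` and `b` of a rational function that is `O(x⁻²)` at infinity and
has no other poles vanishes. -/
lemma coeff_taylor_add_coeff_taylor_eq_zero {B B' D : ℂ[X]}
    (h : (D * (B * (X - C b) ^ (l + 1) + B' * (X - C a) ^ (k + 1))).natDegree ≤ k + l) :
    (taylor a (D * B)).coeff k + (taylor b (D * B')).coeff l = 0 := by
  set P : ℂ[X] := (X - C a) ^ (k + 1) with hP
  set Q : ℂ[X] := (X - C b) ^ (l + 1) with hQ
  have hPm : P.Monic := (monic_X_sub_C a).pow _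
  have hQm : Q.Monic := (monic_X_sub_C b).pow _
  have hPd : P.natDegree = k + 1 := by rw [hP, natDegree_pow, natDegree_X_sub_C, mul_one]
  have hQd : Q.natDegree = l + 1 := by rw [hQ, natDegree_pow, natDegree_X_sub_C, mul_one]
  have hdiv := modByMonic_add_div (D * B) P
  have hdiv' := modByMonic_add_div (D * B') Q
  have hR : ((D * B) %ₘ P).natDegree ≤ k := by
    have := natDegree_modByMonic_lt (D * B) hPm (by
      intro h1; rw [h1, natDegree_one] at hPd; omega)
    omega
  have hR' : ((D * B') %ₘ Q).natDegree ≤ l := by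
    have := natDegree_modByMonic_lt (D * B') hQm (by
      intro h1; rw [h1, natDegree_one] at hQd; omega)
    omega
  set R := (D * B) %ₘ P
  set R' := (D * B') %ₘ Q
  -- The residue at `a` ignores multiples of `(x - a)^(k+1)`, and on a remainder of degree at most
  -- `k` it is the coefficient of `x^k`.
  have e1 : (taylor a (D * B)).coeff k = R.coeff k := by
    rw [← hdiv, map_add, coeff_add, coeff_taylor_of_natDegree_le hR, taylor_mul, hP, taylor_pow,
      map_sub, taylor_X, taylor_C, add_sub_cancel_right, coeff_X_pow_mul', if_neg (by omega),
      add_zero]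
  have e2 : (taylor b (D * B')).coeff l = R'.coeff l := by
    rw [← hdiv', map_add, coeff_add, coeff_taylor_of_natDegree_le hR', taylor_mul, hQ, taylor_pow,
      map_sub, taylor_X, taylor_C, add_sub_cancel_right, coeff_X_pow_mul', if_neg (by omega),
      add_zero]
  rw [e1, e2]
  have hRQ : (R * Q).natDegree ≤ k + l + 1 := natDegree_mul_le.trans (by omega)
  have hRP : (R' * P).natDegree ≤ k + l + 1 := natDegree_mul_le.trans (by omega)
  have hsum : D * (B * Q + B' * P) = (R * Q + R' * P)
      + ((D * B) /ₘ P + (D * B') /ₘ Q) * (P * Q) := by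
    linear_combination (-Q) * hdiv - P * hdiv'
  -- This is the polynomial part of the rational function, which is zero by degree.
  have hS : (D * B) /ₘ P + (D * B') /ₘ Q = 0 := by
    by_contra hne
    have h1 := (hPm.mul hQm).natDegree_mul' hne
    rw [hPm.natDegree_mul hQm, hPd, hQd] at h1
    have h2 : (((D * B) /ₘ P + (D * B') /ₘ Q) * (P * Q)).natDegree ≤ k + l + 1 := by
      rw [← sub_eq_iff_eq_add'.2 hsum]
      exact (natDegree_sub_le _ _).trans (max_le (by omega)
        ((natDegree_add_le _ _).trans (max_le hRQ hRP)))
    rw [mul_comm] at h2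
    omega
  rw [hS, zero_mul, add_zero] at hsum
  have h3 : (R * Q + R' * P).coeff (k + l + 1) = 0 := by
    rw [← hsum]; exact coeff_eq_zero_of_natDegree_lt (by omega)
  have h4 : (R * Q).coeff (k + l + 1) = R.coeff k := by
    rw [show k + l + 1 = k + (l + 1) by ring, coeff_mul_add_eq_of_natDegree_le hR hQd.le,
      ← hQd, hQm.coeff_natDegree, mul_one]
  have h5 : (R' * P).coeff (k + l + 1) = R'.coeff l := by
    rw [show k + l + 1 = l + (k + 1) by ring, coeff_mul_add_eq_of_natDegree_le hR' hPd.le,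
      ← hPd, hPm.coeff_natDegree, mul_one]
  rwa [coeff_add, h4, h5] at h3

end PartialFractions

/-! ### Generating functions of residues. -/

section Borel

/-- The polynomial `∑ b_(k-j) v^j / j!`; times `e^(v s)` it is the residue at `s` of
`e^(v x) B(x) / (x - s)^(k+1)`, if `b_i` are the Taylor coefficients of `B` at `s`. -/
def borelPoly (k : ℕ) (s : ℂ) (B : ℂ[X]) : ℂ[X] :=
  ∑ j ∈ Finset.range (k + 1), C ((taylor s B).coeff (k - j) / (j.factorial : ℂ)) * X ^ j

lemma coeff_borelPoly (k : ℕ) (s : ℂ) (B : ℂ[X]) (j : ℕ) :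
    (borelPoly k s B).coeff j
      = if j ≤ k then (taylor s B).coeff (k - j) / (j.factorial : ℂ) else 0 := by
  simp only [borelPoly, finsetSum_coeff, coeff_C_mul_X_pow, Finset.sum_ite_eq, Finset.mem_range,
    Nat.lt_succ_iff]

lemma natDegree_borelPoly {k : ℕ} {s : ℂ} {B : ℂ[X]} (h : B.eval s ≠ 0) :
    (borelPoly k s B).natDegree = k := by
  refine natDegree_eq_of_le_of_coeff_ne_zero ?_ ?_
  · rw [natDegree_le_iff_coeff_eq_zero]
    intro j hj
    rw [coeff_borelPoly, if_neg (by omega)]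
  · rw [coeff_borelPoly, if_pos le_rfl, Nat.sub_self, taylor_coeff_zero]
    exact div_ne_zero h (Nat.cast_ne_zero.2 k.factorial_ne_zero)

/-- The Taylor series of `e^(s v)` in `v`. -/
def expSeries (s : ℂ) : PowerSeries ℂ := PowerSeries.mk fun k => s ^ k / (k.factorial : ℂ)

lemma derivative_expSeries (s : ℂ) :
    PowerSeries.derivative ℂ (expSeries s) = PowerSeries.C s * expSeries s := by
  ext k
  rw [PowerSeries.coeff_derivative, PowerSeries.coeff_C_mul, expSeries, PowerSeries.coeff_mk,
    PowerSeries.coeff_mk, Nat.factorial_succ]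
  have h1 : (k.factorial : ℂ) ≠ 0 := Nat.cast_ne_zero.2 k.factorial_ne_zero
  have h2 : ((k + 1 : ℕ) : ℂ) ≠ 0 := Nat.cast_ne_zero.2 k.succ_ne_zero
  push_cast at h2 ⊢
  field_simp
  ring

lemma isUnit_expSeries (s : ℂ) : IsUnit (expSeries s) := by
  rw [PowerSeries.isUnit_iff_constantCoeff, ← PowerSeries.coeff_zero_eq_constantCoeff_apply,
    expSeries, PowerSeries.coeff_mk]
  simp

/-- Expanding `e^(vx)` in powers of `v` under the residue gives the residue of `x^n B / (x -
s)^(k+1)` over `n!`. Formally, both sides are the same sum over `j ≤ min k n`. -/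
lemma coeff_expSeries_mul_borelPoly (k : ℕ) (s : ℂ) (B : ℂ[X]) (n : ℕ) :
    PowerSeries.coeff n (expSeries s * (borelPoly k s B : PowerSeries ℂ))
      = (taylor s (X ^ n * B)).coeff k / (n.factorial : ℂ) := by
  rw [mul_comm, PowerSeries.coeff_mul, taylor_mul, taylor_X_pow, Polynomial.coeff_mul,
    Finset.Nat.sum_antidiagonal_eq_sum_range_succ_mk,
    Finset.Nat.sum_antidiagonal_eq_sum_range_succ_mk, Finset.sum_div]
  set F : ℕ → ℂ := fun j => if j ≤ k ∧ j ≤ n then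
    (taylor s B).coeff (k - j) / (j.factorial : ℂ) * (s ^ (n - j) / ((n - j).factorial : ℂ)) else 0
    with hF
  have hn : (n.factorial : ℂ) ≠ 0 := Nat.cast_ne_zero.2 n.factorial_ne_zero
  have h1 : ∀ j, j ∉ Finset.range n.succ → F j = 0 := fun j hj => by
    rw [Finset.mem_range] at hj
    exact if_neg fun h => by omega
  have h2 : ∀ j, j ∉ Finset.range k.succ → F j = 0 := fun j hj => by
    rw [Finset.mem_range] at hj
    exact if_neg fun h => by omega
  trans ∑ j ∈ Finset.range (n + k + 1), F j
  · refine Finset.sum_subset_zero_on_sdiff (Finset.range_subset_range.2 (by omega))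
      (fun j hj => h1 j (Finset.mem_sdiff.1 hj).2) fun j hj => ?_
    rw [Polynomial.coeff_coe, coeff_borelPoly, expSeries, PowerSeries.coeff_mk]
    have hjn : j ≤ n := Nat.lt_succ_iff.1 (Finset.mem_range.1 hj)
    by_cases hk : j ≤ k <;> simp [hF, hk, hjn]
  · refine (Finset.sum_subset_zero_on_sdiff (Finset.range_subset_range.2 (by omega))
      (fun j hj => h2 j (Finset.mem_sdiff.1 hj).2) fun j hj => ?_).symm
    have hjk : j ≤ k := Nat.lt_succ_iff.1 (Finset.mem_range.1 hj)
    rw [coeff_X_add_C_pow]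
    by_cases hjn : j ≤ n
    · rw [hF, Nat.cast_choose ℂ hjn]
      simp only [hjk, hjn, and_self, if_true]
      field_simp
    · simp [hF, hjn, Nat.choose_eq_zero_of_lt (not_le.1 hjn)]

lemma X_pow_dvd_expSeries_mul_borelPoly {a b : ℂ} {k l n : ℕ} {B B' : ℂ[X]}
    (h : (B * (X - C b) ^ (l + 1) + B' * (X - C a) ^ (k + 1)).natDegree + n ≤ k + l) :
    (PowerSeries.X : PowerSeries ℂ) ^ (n + 1) ∣
      expSeries a * (borelPoly k a B : PowerSeries ℂ)
        + expSeries b * (borelPoly l b B' : PowerSeries ℂ) := by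
  rw [PowerSeries.X_pow_dvd_iff]
  intro i hi
  rw [map_add, coeff_expSeries_mul_borelPoly, coeff_expSeries_mul_borelPoly, ← add_div,
    coeff_taylor_add_coeff_taylor_eq_zero, zero_div]
  refine natDegree_mul_le.trans ?_
  rw [natDegree_X_pow]; omega

end Borel

/-! ### From a combination with a high order zero to divisibility of the Wronskian. -/

section WronskianOrder

lemma X_pow_dvd_derivative {f : PowerSeries ℂ} {n : ℕ}
    (h : (PowerSeries.X : PowerSeries ℂ) ^ (n + 1) ∣ f) :
    (PowerSeries.X : PowerSeries ℂ) ^ n ∣ PowerSeries.derivative ℂ f := by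
  rw [PowerSeries.X_pow_dvd_iff] at h ⊢
  intro i hi
  rw [PowerSeries.coeff_derivative, h (i + 1) (by omega), zero_mul]

lemma X_pow_dvd_of_coe {p : ℂ[X]} {n : ℕ}
    (h : (PowerSeries.X : PowerSeries ℂ) ^ n ∣ (p : PowerSeries ℂ)) : X ^ n ∣ p := by
  rw [PowerSeries.X_pow_dvd_iff] at h
  rw [Polynomial.X_pow_dvd_iff]
  intro i hi
  simpa using h i hi

/-- For the combination `H`, the expression `H' q - H (q' + z₂ q)` is the twisted Wronskian times
the unit `c₁ e^(z₁ v)`. Only the term with `H'` has lost an order, and a zero of `q` restores it. -/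
lemma X_pow_dvd_twistedWronskian_of_left {z₁ z₂ c₁ c₂ : ℂ} {p q : ℂ[X]} {n : ℕ} (hc : c₁ ≠ 0)
    (h : (PowerSeries.X : PowerSeries ℂ) ^ (n + 1) ∣
      PowerSeries.C c₁ * (expSeries z₁ * (p : PowerSeries ℂ))
        + PowerSeries.C c₂ * (expSeries z₂ * (q : PowerSeries ℂ))) :
    X ^ n ∣ twistedWronskian (z₁ - z₂) p q ∧
      (q.eval 0 = 0 → X ^ (n + 1) ∣ twistedWronskian (z₁ - z₂) p q) := by
  set H := PowerSeries.C c₁ * (expSeries z₁ * (p : PowerSeries ℂ))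
        + PowerSeries.C c₂ * (expSeries z₂ * (q : PowerSeries ℂ)) with hH
  have hd := X_pow_dvd_derivative h
  have hder : PowerSeries.derivative ℂ H
      = PowerSeries.C c₁ * (expSeries z₁ * (((derivative p + C z₁ * p : ℂ[X])) : PowerSeries ℂ))
        + PowerSeries.C c₂ * (expSeries z₂ * (((derivative q + C z₂ * q : ℂ[X])) : PowerSeries ℂ)) := by
    simp only [hH, map_add, Derivation.leibniz, derivative_expSeries, smul_eq_mul,
      PowerSeries.derivative_C, PowerSeries.derivative_coe, Polynomial.coe_add, Polynomial.coe_mul,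
      Polynomial.coe_C]
    ring
  have hkey : PowerSeries.derivative ℂ H * (q : PowerSeries ℂ)
      - H * ((derivative q + C z₂ * q : ℂ[X]) : PowerSeries ℂ)
      = (PowerSeries.C c₁ * expSeries z₁) *
        ((twistedWronskian (z₁ - z₂) p q : ℂ[X]) : PowerSeries ℂ) := by
    rw [hder, hH]
    simp only [twistedWronskian, Polynomial.coe_add, Polynomial.coe_mul,
      Polynomial.coe_C, Polynomial.coe_sub, map_sub]
    ring
  have hu : IsUnit (PowerSeries.C c₁ * expSeries z₁) :=
    (hc.isUnit.map PowerSeries.C).mul (isUnit_expSeries z₁)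
  constructor
  · apply X_pow_dvd_of_coe
    rw [← hu.dvd_mul_left, ← hkey]
    exact dvd_sub (hd.mul_right _) (((pow_dvd_pow _ n.le_succ).trans h).mul_right _)
  · intro hq
    apply X_pow_dvd_of_coe
    rw [← hu.dvd_mul_left, ← hkey]
    refine dvd_sub ?_ (h.mul_right _)
    rw [pow_succ]
    refine mul_dvd_mul hd (PowerSeries.X_dvd_iff.2 ?_)
    rw [← PowerSeries.coeff_zero_eq_constantCoeff_apply, Polynomial.coeff_coe,
      coeff_zero_eq_eval_zero, hq]

lemma X_pow_dvd_twistedWronskian {z c : Fin 2 → ℂ} {p : Fin 2 → ℂ[X]} {n : ℕ} (hc : ∃ a, c a ≠ 0)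
    (h : (PowerSeries.X : PowerSeries ℂ) ^ (n + 1) ∣
      ∑ a, PowerSeries.C (c a) * (expSeries (z a) * (p a : PowerSeries ℂ))) :
    X ^ n ∣ twistedWronskian (z 0 - z 1) (p 0) (p 1) ∧
      ((∀ a, (p a).eval 0 = 0) → X ^ (n + 1) ∣ twistedWronskian (z 0 - z 1) (p 0) (p 1)) := by
  rw [Fin.sum_univ_two] at h
  by_cases h0 : c 0 = 0
  · have h1 : c 1 ≠ 0 := by
      obtain ⟨a, ha⟩ := hc
      fin_cases a
      · exact absurd h0 ha
      · exact ha
    rw [add_comm (PowerSeries.C (c 0) * _)] at h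
    have := X_pow_dvd_twistedWronskian_of_left h1 h
    rw [← neg_sub (z 0) (z 1), twistedWronskian_swap, dvd_neg, dvd_neg] at this
    exact ⟨this.1, fun h => this.2 (h 0)⟩
  · have := X_pow_dvd_twistedWronskian_of_left h0 h
    exact ⟨this.1, fun h => this.2 (h 1)⟩

lemma X_sub_C_pow_dvd_twistedWronskian {z c : Fin 2 → ℂ} {g : Fin 2 → ℂ[X]} {n : ℕ} {s : ℂ}
    (hc : ∃ a, c a ≠ 0)
    (h : (PowerSeries.X : PowerSeries ℂ) ^ (n + 1) ∣
      ∑ a, PowerSeries.C (c a) * (expSeries (z a) * ((taylor s (g a) : ℂ[X]) : PowerSeries ℂ))) :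
    (X - C s) ^ n ∣ twistedWronskian (z 0 - z 1) (g 0) (g 1) ∧
      ((∀ a, (g a).eval s = 0) →
        (X - C s) ^ (n + 1) ∣ twistedWronskian (z 0 - z 1) (g 0) (g 1)) := by
  have h1 := X_pow_dvd_twistedWronskian hc h
  have h2 := twistedWronskian_comp_affine (z 0 - z 1) 1 s (g 0) (g 1)
  simp only [C_1, one_mul, mul_one, ← taylor_apply] at h2
  rw [← h2] at h1
  have h3 : ∀ (j : ℕ) (f : ℂ[X]), X ^ j ∣ taylor s f → (X - C s) ^ j ∣ f := by
    rintro j f ⟨q, hq⟩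
    refine ⟨taylor (-s) q, ?_⟩
    have := congrArg (taylor (-s)) hq
    rw [taylor_taylor, neg_add_cancel, taylor_zero, taylor_mul, taylor_X_pow, C_neg,
      ← sub_eq_add_neg] at this
    exact this
  exact ⟨h3 _ _ h1.1, fun hg => h3 _ _ (h1.2 fun a => by rw [taylor_eval, zero_add, hg a])⟩

end WronskianOrder

/-! ### Contour integrals as residues. -/

section Contour

variable {a b : ℂ} {k l : ℕ} {r : ℝ}

lemma sub_ne_zero_of_mem_sphere {c x : ℂ} (hr : 0 < r) (hx : x ∈ Metric.sphere c r) :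
    x - c ≠ 0 := by
  rw [sub_ne_zero]
  rintro rfl
  simp at hx
  exact hr.ne hx

lemma sub_ne_zero_of_mem_closedBall {c x : ℂ} (hrb : r < dist b c)
    (hx : x ∈ Metric.closedBall c r) : x - b ≠ 0 := by
  rw [sub_ne_zero]
  rintro rfl
  exact not_lt.2 (Metric.mem_closedBall.1 hx) hrb

lemma circleIntegral_exp_mul_div_pow (hr : 0 < r) (v : ℂ) {B : ℂ[X]} (hB : B.natDegree ≤ k) :
    (∮ x in C(a, r), Complex.exp (v * x) * (B.eval x / (x - a) ^ (k + 1)))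
      = 2 * Real.pi * Complex.I * ((borelPoly k a B).eval v * Complex.exp (v * a)) := by
  have hone : ∀ j : ℕ, (∮ x in C(a, r), (1 / (x - a) ^ (j + 1)) * Complex.exp (v * x))
      = 2 * Real.pi * Complex.I / j.factorial * (v ^ j * Complex.exp (v * a)) := by
    intro j
    have h1 : DifferentiableOn ℂ (fun x => Complex.exp (v * x)) (Metric.closedBall a r) := by
      fun_prop
    have h2 := h1.circleIntegral_one_div_sub_center_pow_smul hr j
    rw [iteratedDeriv_cexp_const_mul] at h2
    exact h2
  have hint : ∀ j : ℕ, CircleIntegrable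
      (fun x => (1 / (x - a) ^ (j + 1)) * Complex.exp (v * x)) a r := by
    intro j
    refine ContinuousOn.circleIntegrable hr.le (ContinuousOn.mul (ContinuousOn.div
      (by fun_prop) (by fun_prop) fun x hx => pow_ne_zero _ (sub_ne_zero_of_mem_sphere hr hx))
      (by fun_prop))
  have hsum : ∀ x ∈ Metric.sphere a r, Complex.exp (v * x) * (B.eval x / (x - a) ^ (k + 1))
      = ∑ j ∈ Finset.range (k + 1), (taylor a B).coeff (k - j) *
        ((1 / (x - a) ^ (j + 1)) * Complex.exp (v * x)) := by
    intro x hx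
    have hx0 := sub_ne_zero_of_mem_sphere hr hx
    rw [← taylor_eval_sub a B x, eval_eq_sum_range' (n := k + 1)
      (by rw [natDegree_taylor]; omega), ← Finset.sum_range_reflect, Finset.sum_div,
      Finset.mul_sum]
    refine Finset.sum_congr rfl fun j hj => ?_
    have hjk : j ≤ k := Nat.lt_succ_iff.1 (Finset.mem_range.1 hj)
    have e1 : k + 1 - 1 - j = k - j := by omega
    have e2 : (x - a) ^ (k + 1) = (x - a) ^ (k - j) * (x - a) ^ (j + 1) := by
      rw [← pow_add]; congr 1; omega
    rw [e1, e2]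
    field_simp
  rw [circleIntegral.integral_congr hr.le hsum, circleIntegral.integral_fun_sum]
  · rw [borelPoly, eval_finsetSum, Finset.sum_mul, Finset.mul_sum]
    refine Finset.sum_congr rfl fun j _ => ?_
    rw [circleIntegral.integral_const_mul, hone]
    simp only [eval_mul, eval_C, eval_pow, eval_X]
    ring
  · intro j _
    simpa using (hint j).const_fun_smul (a := (taylor a B).coeff (k - j))

lemma circleIntegral_exp_mul_partial_fractions (hr : 0 < r) (hrb : r < dist b a) (v : ℂ)
    {A B B' : ℂ[X]} (hB : B.natDegree ≤ k)
    (hA : A = B * (X - C b) ^ (l + 1) + B' * (X - C a) ^ (k + 1)) :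
    (∮ x in C(a, r), Complex.exp (v * x) * (A.eval x / ((x - a) ^ (k + 1) * (x - b) ^ (l + 1))))
      = 2 * Real.pi * Complex.I * ((borelPoly k a B).eval v * Complex.exp (v * a)) := by
  have hd : DifferentiableOn ℂ (fun x => Complex.exp (v * x) * (B'.eval x / (x - b) ^ (l + 1)))
      (Metric.closedBall a r) := by
    refine DifferentiableOn.mul (by fun_prop) (DifferentiableOn.div
      B'.differentiable.differentiableOn (by fun_prop) fun x hx =>
        pow_ne_zero _ (sub_ne_zero_of_mem_closedBall hrb hx))
  have hsum : ∀ x ∈ Metric.sphere a r,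
      Complex.exp (v * x) * (A.eval x / ((x - a) ^ (k + 1) * (x - b) ^ (l + 1)))
      = Complex.exp (v * x) * (B.eval x / (x - a) ^ (k + 1))
        + Complex.exp (v * x) * (B'.eval x / (x - b) ^ (l + 1)) := by
    intro x hx
    have h1 := sub_ne_zero_of_mem_sphere hr hx
    have h2 := sub_ne_zero_of_mem_closedBall hrb (Metric.sphere_subset_closedBall hx)
    rw [hA]
    simp only [eval_add, eval_mul, eval_pow, eval_sub, eval_X, eval_C]
    field_simp
  rw [circleIntegral.integral_congr hr.le hsum, circleIntegral.integral_add,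
    circleIntegral_exp_mul_div_pow hr v hB,
    (hd.mono Metric.closure_ball_subset_closedBall).diffContOnCl.circleIntegral_eq_zero hr.le, add_zero]
  · refine ContinuousOn.circleIntegrable hr.le (ContinuousOn.mul (by fun_prop) (ContinuousOn.div
      B.continuous.continuousOn (by fun_prop) fun x hx =>
        pow_ne_zero _ (sub_ne_zero_of_mem_sphere hr hx)))
  · exact ContinuousOn.circleIntegrable hr.le
      (hd.continuousOn.mono Metric.sphere_subset_closedBall)

lemma circleIntegral_eq_zero_of_le_analyticOrderAt (hr : 0 < r) {f : ℂ → ℂ}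
    (hf : DifferentiableOn ℂ f (Metric.closedBall a r))
    (ho : ((k + 1 : ℕ) : ℕ∞) ≤ analyticOrderAt f a) :
    (∮ x in C(a, r), (1 / (x - a) ^ (k + 1)) • f x) = 0 := by
  have han : AnalyticAt ℂ f a := hf.analyticAt (Metric.closedBall_mem_nhds a hr)
  rw [hf.circleIntegral_one_div_sub_center_pow_smul hr k,
    (natCast_le_analyticOrderAt_iff_iteratedDeriv_eq_zero han).1 ho k k.lt_succ_self, smul_zero]

end Contour

/-! ### The conjugate space and the special bispectral dual. -/

section Conjugate

variable {lam z : Fin 2 → ℂ} {m : Fin 2 → ℕ} {p : Fin 2 → ℂ[X]} {c : ℂ}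

/-- The functions `f / (T e^((λ₁ + λ₂) x))`, where `f` runs over the space spanned by the
`p_i e^(λ_i x)` and `T = (x - z₁)^(m₁) (x - z₂)^(m₂)`. -/
def conjugateFun (lam z : Fin 2 → ℂ) (m : Fin 2 → ℕ) (p : Fin 2 → ℂ[X]) (d : Fin 2 → ℂ) (x : ℂ) :
    ℂ :=
  (∑ i, d i * ((p i).eval x * Complex.exp (lam i * x))) /
    ((fusionPoly z m).eval x * Complex.exp ((lam 0 + lam 1) * x))

lemma wronskian_sum_quasi
    (h : twistedWronskian (lam 0 - lam 1) (p 0) (p 1) = C c * fusionPoly z m)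
    (d e : Fin 2 → ℂ) :
    wronskian (fun s => ∑ i, d i * ((p i).eval s * Complex.exp (lam i * s)))
      (fun s => ∑ i, e i * ((p i).eval s * Complex.exp (lam i * s)))
    = fun s => (c * (d 1 * e 0 - d 0 * e 1)) * ((fusionPoly z m).eval s
        * Complex.exp ((lam 0 + lam 1) * s)) := by
  ext s
  have h1 := deriv_mul_sub_mul_deriv_sum_quasi lam d e p s
  rw [h, eval_mul, eval_C] at h1
  rw [wronskian]
  linear_combination -h1

lemma mem_conjugateSpace_iff (hlam : lam 0 ≠ lam 1) (hp : ∀ i, p i ≠ 0) (hc : c ≠ 0)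
    (h : twistedWronskian (lam 0 - lam 1) (p 0) (p 1) = C c * fusionPoly z m) {f : ℂ → ℂ} :
    f ∈ conjugateSpace (quasiSpan lam p) ↔ ∃ d, f = conjugateFun lam z m p d := by
  have hadd : ∀ d e, conjugateFun lam z m p d + conjugateFun lam z m p e
      = conjugateFun lam z m p (d + e) := by
    intro d e; ext x
    simp only [conjugateFun, Pi.add_apply, add_mul, Finset.sum_add_distrib, add_div]
  have hsmul : ∀ (s : ℂ) d, s • conjugateFun lam z m p d = conjugateFun lam z m p (s • d) := by
    intro s d; ext x
    simp only [conjugateFun, Pi.smul_apply, smul_eq_mul, mul_assoc, ← Finset.mul_sum, mul_div_assoc]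
  constructor
  · intro hf
    induction hf using Submodule.span_induction with
    | mem F hF =>
      obtain ⟨f, hf, g, hg, k, hk, -, rfl⟩ := hF
      obtain ⟨d, rfl⟩ := mem_quasiSpan_iff.1 hf
      obtain ⟨e, rfl⟩ := mem_quasiSpan_iff.1 hg
      obtain ⟨e', rfl⟩ := mem_quasiSpan_iff.1 hk
      -- The Wronskian is this constant times the fixed denominator of `conjugateFun`.
      refine ⟨(c * (e 1 * e' 0 - e 0 * e' 1))⁻¹ • d, ?_⟩
      rw [← hsmul]
      ext x
      rw [wronskian_sum_quasi h, Pi.smul_apply, conjugateFun, smul_eq_mul, div_eq_mul_inv,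
        div_eq_mul_inv, mul_inv]
      ring
    | zero => exact ⟨0, by ext x; simp [conjugateFun]⟩
    | add f g _ _ hf hg =>
      obtain ⟨d, rfl⟩ := hf
      obtain ⟨e, rfl⟩ := hg
      exact ⟨d + e, hadd d e⟩
    | smul s f _ hf =>
      obtain ⟨d, rfl⟩ := hf
      exact ⟨s • d, hsmul s d⟩
  · rintro ⟨d, rfl⟩
    -- The basis is ordered and scaled so that its Wronskian is exactly `T e^((λ₁ + λ₂)x)`.
    refine Submodule.subset_span ⟨_, mem_quasiSpan_iff.2 ⟨d, rfl⟩,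
      _, mem_quasiSpan_iff.2 ⟨![0, 1], rfl⟩, _, mem_quasiSpan_iff.2 ⟨![c⁻¹, 0], rfl⟩, ?_, ?_⟩
    · rw [LinearIndependent.pair_iff]
      intro s t hst
      have h1 := eq_zero_of_sum_quasi_eq_zero hlam
        (p := fun i => C (![t * c⁻¹, s] i) * p i) (fun x => by
          have := congrFun hst x
          simp only [Fin.sum_univ_two, Matrix.cons_val_zero, Matrix.cons_val_one, Pi.add_apply,
            Pi.smul_apply, smul_eq_mul, Pi.zero_apply, eval_mul, eval_C] at this ⊢
          linear_combination this)
      have h2 := h1 0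
      have h3 := h1 1
      simp only [Matrix.cons_val_zero, Matrix.cons_val_one, mul_eq_zero, C_eq_zero, hp, or_false,
        inv_eq_zero, hc] at h2 h3
      exact ⟨h3, h2⟩
    · ext x
      rw [wronskian_sum_quasi h, conjugateFun]
      have : c * ((![0, 1] : Fin 2 → ℂ) 1 * (![c⁻¹, 0] : Fin 2 → ℂ) 0
          - (![0, 1] : Fin 2 → ℂ) 0 * (![c⁻¹, 0] : Fin 2 → ℂ) 1) = 1 := by
        simp [hc]
      simp only [this, one_mul]

end Conjugate

section Dual

variable {lam z : Fin 2 → ℂ} {m : Fin 2 → ℕ} {p : Fin 2 → ℂ[X]} {c : ℂ}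

/-- The contour integral `∮ e^(u x) f(x) ∏ (x - z_b)⁻¹ dx` over the circle of radius `r` around
`z_a`, as a function of `u`. -/
def contourTransform (z : Fin 2 → ℂ) (a : Fin 2) (r : ℝ) (f : ℂ → ℂ) (u : ℂ) : ℂ :=
  ∮ x in C(z a, r), Complex.exp (u * x) * f x * ∏ b, (x - z b)⁻¹

lemma prod_fin_two_eq {M : Type*} [CommMonoid M] (f : Fin 2 → M) (a : Fin 2) :
    ∏ b, f b = f a * f (a + 1) := by
  fin_cases a
  · simp
  · rw [Fin.prod_univ_two, mul_comm]; rfl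

lemma fin_two_ne_add_one (a : Fin 2) : a + 1 ≠ a := by
  fin_cases a <;> decide

lemma fusionPoly_eq (z : Fin 2 → ℂ) (m : Fin 2 → ℕ) (a : Fin 2) :
    fusionPoly z m = (X - C (z a)) ^ m a * (X - C (z (a + 1))) ^ m (a + 1) :=
  prod_fin_two_eq _ a

/-- Dividing `e^(λ_i x)` by `e^((λ₁ + λ₂)x)` leaves minus the other exponent; `i + 1` in `Fin 2` is
the other index. -/
lemma contourTransform_conjugateFun (a : Fin 2) {r : ℝ} (hr : 0 < r)
    (hrb : ∀ b, b ≠ a → r < dist (z b) (z a)) (d : Fin 2 → ℂ) (u : ℂ) :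
    contourTransform z a r (conjugateFun lam z m p d) u = ∑ i, d i *
      ∮ x in C(z a, r), Complex.exp ((u - lam (i + 1)) * x) * ((p i).eval x /
        ((x - z a) ^ (m a + 1) * (x - z (a + 1)) ^ (m (a + 1) + 1))) := by
  have hb := hrb (a + 1) (fin_two_ne_add_one a)
  have hsum : ∀ x ∈ Metric.sphere (z a) r, Complex.exp (u * x) * conjugateFun lam z m p d x
        * ∏ b, (x - z b)⁻¹
      = ∑ i, d i * (Complex.exp ((u - lam (i + 1)) * x) * ((p i).eval x /
        ((x - z a) ^ (m a + 1) * (x - z (a + 1)) ^ (m (a + 1) + 1)))) := by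
    intro x hx
    have h1 := sub_ne_zero_of_mem_sphere hr hx
    have h2 := sub_ne_zero_of_mem_closedBall hb (Metric.sphere_subset_closedBall hx)
    have h3 := Complex.exp_ne_zero ((lam 0 + lam 1) * x)
    have he : ∀ i, Complex.exp ((u - lam (i + 1)) * x)
        = Complex.exp (u * x) * Complex.exp (lam i * x) / Complex.exp ((lam 0 + lam 1) * x) := by
      intro i
      rw [← Complex.exp_add, ← Complex.exp_sub]
      congr 1
      have : lam 0 + lam 1 = lam i + lam (i + 1) := by
        fin_cases i
        · simp
        · exact add_comm _ _
      rw [this]; ring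
    rw [prod_fin_two_eq _ a, conjugateFun, fusionPoly_eq z m a, Finset.sum_div, Finset.mul_sum,
      Finset.sum_mul]
    refine Finset.sum_congr rfl fun i _ => ?_
    rw [he]
    simp only [eval_mul, eval_pow, eval_sub, eval_X, eval_C]
    field_simp
    ring
  rw [contourTransform, circleIntegral.integral_congr hr.le hsum, circleIntegral.integral_fun_sum]
  · exact Finset.sum_congr rfl fun i _ => circleIntegral.integral_const_mul _ _ _ _
  · intro i _
    refine ContinuousOn.circleIntegrable hr.le (ContinuousOn.mul (by fun_prop)
      (ContinuousOn.mul (by fun_prop) (ContinuousOn.div (p i).continuous.continuousOn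
        (by fun_prop) fun x hx => ?_)))
    exact mul_ne_zero (pow_ne_zero _ (sub_ne_zero_of_mem_sphere hr hx)) (pow_ne_zero _
      (sub_ne_zero_of_mem_closedBall hb (Metric.sphere_subset_closedBall hx)))

/-- A function of the space that vanishes at `z_a`, independent of one that does not, vanishes to
order `m_a + 1`, which cancels the pole of the integrand. -/
lemma contourTransform_eq_zero (hz : Function.Injective z) (hc : c ≠ 0)
    (h : twistedWronskian (lam 0 - lam 1) (p 0) (p 1) = C c * fusionPoly z m)
    (a : Fin 2) {r : ℝ} (hr : 0 < r)
    (hrb : ∀ b, b ≠ a → r < dist (z b) (z a)) {d e : Fin 2 → ℂ} (hde : d 0 * e 1 - d 1 * e 0 ≠ 0)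
    (hd : ∑ i, d i * ((p i).eval (z a) * Complex.exp (lam i * z a)) = 0)
    (he : ∑ i, e i * ((p i).eval (z a) * Complex.exp (lam i * z a)) ≠ 0) (u : ℂ) :
    contourTransform z a r (conjugateFun lam z m p d) u = 0 := by
  have hb := hrb (a + 1) (fin_two_ne_add_one a)
  set F : ℂ → ℂ := fun s => ∑ i, d i * ((p i).eval s * Complex.exp (lam i * s)) with hF
  set G : ℂ → ℂ := fun s => Complex.exp (u * s) / (Complex.exp ((lam 0 + lam 1) * s)
    * (s - z (a + 1)) ^ (m (a + 1) + 1)) with hG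
  have hFan : ∀ s, AnalyticAt ℂ F s := fun s => analyticAt_sum_quasi lam d p s
  have hGd : ∀ s ∈ Metric.closedBall (z a) r, AnalyticAt ℂ G s := fun s hs =>
    AnalyticAt.fun_div (by fun_prop) (by fun_prop) (mul_ne_zero (Complex.exp_ne_zero _)
      (pow_ne_zero _ (sub_ne_zero_of_mem_closedBall hb hs)))
  have hza : z a ∈ Metric.closedBall (z a) r := Metric.mem_closedBall_self hr.le
  have hord : ((m a + 1 : ℕ) : ℕ∞) ≤ analyticOrderAt (F * G) (z a) := by
    rw [fusionPoly_eq z m a] at h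
    have hT : ((X - C (z (a + 1))) ^ m (a + 1)).eval (z a) ≠ 0 := by
      rw [eval_pow, eval_sub, eval_X, eval_C]
      exact pow_ne_zero _ (sub_ne_zero.2 (hz.ne (fin_two_ne_add_one a).symm))
    rw [analyticOrderAt_mul (hFan _) (hGd _ hza), hF,
      analyticOrderAt_sum_quasi hc h hT hde hd he]
    exact le_self_add
  have hdiff : DifferentiableOn ℂ (F * G) (Metric.closedBall (z a) r) := fun s hs =>
    ((hFan s).mul (hGd s hs)).differentiableAt.differentiableWithinAt
  rw [contourTransform, ← circleIntegral_eq_zero_of_le_analyticOrderAt hr hdiff hord]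
  refine circleIntegral.integral_congr hr.le fun x hx => ?_
  have h1 := sub_ne_zero_of_mem_sphere hr hx
  have h2 := sub_ne_zero_of_mem_closedBall hb (Metric.sphere_subset_closedBall hx)
  have h3 := Complex.exp_ne_zero ((lam 0 + lam 1) * x)
  simp only [conjugateFun, prod_fin_two_eq _ a, fusionPoly_eq z m a, hG, Pi.mul_apply, smul_eq_mul,
    eval_mul, eval_pow, eval_sub, eval_X, eval_C]
  change Complex.exp (u * x) * (F x / _) * _ = _
  field_simp
  ring

lemma exists_radius (hz : Function.Injective z) (a : Fin 2) :
    ∃ r : ℝ, 0 < r ∧ ∀ b, b ≠ a → r < dist (z b) (z a) := by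
  have h1 : 0 < dist (z (a + 1)) (z a) := dist_pos.2 (hz.ne (fin_two_ne_add_one a))
  refine ⟨dist (z (a + 1)) (z a) / 2, by linarith, fun b hb => ?_⟩
  have : b = a + 1 := by
    fin_cases a <;> fin_cases b <;> first | rfl | exact absurd rfl hb
  rw [this]; linarith

lemma exists_partial_fractions_fin_two (hz : Function.Injective z) {A : ℂ[X]}
    (hA : A.natDegree ≤ m 0 + m 1 + 1) :
    ∃ B : Fin 2 → ℂ[X], (∀ a, (B a).natDegree ≤ m a) ∧
      ∀ a, A = B a * (X - C (z (a + 1))) ^ (m (a + 1) + 1) +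
        B (a + 1) * (X - C (z a)) ^ (m a + 1) := by
  obtain ⟨B, B', hB, hB', h⟩ := exists_partial_fractions (hz.ne zero_ne_one) hA
  refine ⟨![B, B'], fun a => ?_, fun a => ?_⟩
  · fin_cases a
    · exact hB
    · exact hB'
  · fin_cases a
    · exact h
    · exact h.trans (add_comm _ _)

/-- Residues of `p₁` define the `g_a`, of full degree because `p₁(z_a) ≠ 0`; those of `p₂` are
multiples of them. The total residue of `p₁` yields the zero at `λ₂`, and that of `p₂` the zero at
`λ₁`. -/
theorem exists_specialBispectralDual_generators {n : Fin 2 → ℕ} (hlam : lam 0 ≠ lam 1)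
    (hz : Function.Injective z) (hp : ∀ i, p i ≠ 0) (hdeg : ∀ i, (p i).natDegree = n i)
    (hnm : n 0 + n 1 = m 0 + m 1) (hc : c ≠ 0)
    (h : twistedWronskian (lam 0 - lam 1) (p 0) (p 1) = C c * fusionPoly z m)
    (h0 : ∀ a, (p 0).eval (z a) ≠ 0) (h1 : ∃ a, (p 1).eval (z a) ≠ 0) :
    ∃ g : Fin 2 → ℂ[X], (∀ a, g a ≠ 0) ∧ (∀ a, (g a).natDegree = m a) ∧
      specialBispectralDual z (quasiSpan lam p) = quasiSpan z g ∧
      ∀ i, ∃ τ : Fin 2 → ℂ, (∃ a, τ a ≠ 0) ∧ (PowerSeries.X : PowerSeries ℂ) ^ (n i + 1) ∣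
        ∑ a, PowerSeries.C (τ a) *
          (expSeries (z a) * ((taylor (lam i) (g a) : ℂ[X]) : PowerSeries ℂ)) := by
  have hle : ∀ i, (p i).natDegree ≤ m 0 + m 1 + 1 := by
    intro i; rw [hdeg]; fin_cases i <;> simp <;> omega
  have e01 : (0 + 1 : Fin 2) = 1 := rfl
  have e11 : (1 + 1 : Fin 2) = 0 := rfl
  choose B hB hBp using fun i => exists_partial_fractions_fin_two hz (hle i)
  obtain ⟨Q, hQ⟩ : ∃ Q : Fin 2 → Fin 2 → ℂ[X], ∀ i a, Q i a = borelPoly (m a) (z a) (B i a) :=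
    ⟨_, fun _ _ => rfl⟩
  have hint : ∀ a r, 0 < r → (∀ b, b ≠ a → r < dist (z b) (z a)) → ∀ d u,
      contourTransform z a r (conjugateFun lam z m p d) u
        = d 0 * (2 * Real.pi * Complex.I * ((Q 0 a).eval (u - lam 1)
            * Complex.exp ((u - lam 1) * z a)))
          + d 1 * (2 * Real.pi * Complex.I * ((Q 1 a).eval (u - lam 0)
            * Complex.exp ((u - lam 0) * z a))) := by
    intro a r hr hrb d u
    rw [contourTransform_conjugateFun a hr hrb, Fin.sum_univ_two, e01, e11, hQ, hQ,
      circleIntegral_exp_mul_partial_fractions hr (hrb _ (fin_two_ne_add_one a)) _ (hB 0 a)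
        (hBp 0 a),
      circleIntegral_exp_mul_partial_fractions hr (hrb _ (fin_two_ne_add_one a)) _ (hB 1 a)
        (hBp 1 a)]
  have hB0 : ∀ a, (B 0 a).eval (z a) ≠ 0 := by
    intro a ha
    refine h0 a ?_
    rw [hBp 0 a, eval_add, eval_mul, ha, zero_mul, zero_add]
    simp
  obtain ⟨g, hg⟩ : ∃ g : Fin 2 → ℂ[X], ∀ a, g a = taylor (-lam 1) (Q 0 a) := ⟨_, fun _ => rfl⟩
  have hgd : ∀ a, (g a).natDegree = m a := fun a => by
    rw [hg, natDegree_taylor, hQ]; exact natDegree_borelPoly (hB0 a)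
  have hg0 : ∀ a, g a ≠ 0 := by
    intro a ha
    rw [hg, taylor_eq_zero] at ha
    have h3 : (Q 0 a).coeff (m a) = 0 := by rw [ha, coeff_zero]
    rw [hQ, coeff_borelPoly, if_pos le_rfl, Nat.sub_self, taylor_coeff_zero] at h3
    exact div_ne_zero (hB0 a) (Nat.cast_ne_zero.2 (m a).factorial_ne_zero) h3
  have hpi : (2 * Real.pi * Complex.I : ℂ) ≠ 0 := Complex.two_pi_I_ne_zero
  have hgQ : ∀ a u, (Q 0 a).eval (u - lam 1) * Complex.exp ((u - lam 1) * z a)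
      = Complex.exp (-(lam 1 * z a)) * ((g a).eval u * Complex.exp (z a * u)) := by
    intro a u
    rw [hg, taylor_eval, ← sub_eq_add_neg, show (u - lam 1) * z a = -(lam 1 * z a) + z a * u by ring,
      Complex.exp_add]
    ring
  -- the second residue is a multiple of the first one
  have hprop : ∀ a, ∃ τ : ℂ, (τ = 0 → (p 1).eval (z a) = 0) ∧
      Q 1 a = C τ * taylor (lam 0) (g a) := by
    intro a
    obtain ⟨r, hr, hrb⟩ := exists_radius hz a
    have hE1 := Complex.exp_ne_zero (lam 1 * z a)
    obtain ⟨P0, hP0⟩ : ∃ P0, P0 = (p 0).eval (z a) * Complex.exp (lam 0 * z a) := ⟨_, rfl⟩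
    obtain ⟨P1, hP1⟩ : ∃ P1, P1 = (p 1).eval (z a) * Complex.exp (lam 1 * z a) := ⟨_, rfl⟩
    have hP0n : P0 ≠ 0 := by rw [hP0]; exact mul_ne_zero (h0 a) (Complex.exp_ne_zero _)
    -- This combination vanishes at `z_a`, so its transform is zero, which is a linear relation
    -- between the two residues.
    have hvan := fun u => contourTransform_eq_zero hz hc h a hr hrb (d := ![P1, -P0])
      (e := ![1, 0]) (by simpa using hP0n) (by
        simp only [Fin.sum_univ_two, Matrix.cons_val_zero, Matrix.cons_val_one, hP0, hP1]
        ring) (by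
        simpa [Fin.sum_univ_two] using h0 a) u
    simp only [hint a r hr hrb, Matrix.cons_val_zero, Matrix.cons_val_one] at hvan
    refine ⟨P1 * Complex.exp ((lam 0 - lam 1) * z a) / P0, fun hτ => ?_, ?_⟩
    · have h2 := (div_eq_zero_iff.1 hτ).resolve_right hP0n
      have h3 := (mul_eq_zero.1 h2).resolve_right (Complex.exp_ne_zero _)
      rw [hP1] at h3
      exact (mul_eq_zero.1 h3).resolve_right hE1
    · refine Polynomial.funext fun v => ?_
      have h2 := hvan (v + lam 0)
      rw [hgQ, add_sub_cancel_right] at h2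
      have hw : Complex.exp (-(lam 1 * z a)) * Complex.exp (z a * (v + lam 0))
          = Complex.exp ((lam 0 - lam 1) * z a) * Complex.exp (v * z a) := by
        rw [← Complex.exp_add, ← Complex.exp_add]; congr 1; ring
      rw [eval_mul, eval_C, taylor_eval, div_mul_eq_mul_div, eq_div_iff hP0n]
      apply mul_left_cancel₀ (mul_ne_zero hpi (Complex.exp_ne_zero (v * z a)))
      linear_combination -h2 + P1 * (2 * Real.pi * Complex.I) * (g a).eval (v + lam 0) * hw
  choose τ hτ hQτ using hprop
  have hspan : specialBispectralDual z (quasiSpan lam p) = quasiSpan z g := by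
    refine le_antisymm (Submodule.span_le.2 ?_) (Submodule.span_le.2 ?_)
    · rintro F ⟨f, hf, a, r, hr, hrb, rfl⟩
      obtain ⟨d, rfl⟩ := (mem_conjugateSpace_iff hlam hp hc h).1 hf
      have hs : contourTransform z a r (conjugateFun lam z m p d)
          = (2 * Real.pi * Complex.I * (d 0 * Complex.exp (-(lam 1 * z a))
            + d 1 * τ a * Complex.exp (-(lam 0 * z a)))) •
            fun u => (g a).eval u * Complex.exp (z a * u) := by
        ext u
        rw [hint a r hr hrb, hgQ, hQτ, eval_mul, eval_C, taylor_eval,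
          sub_add_cancel, show (u - lam 0) * z a = -(lam 0 * z a) + z a * u by ring,
          Complex.exp_add, Pi.smul_apply, smul_eq_mul]
        ring
      change contourTransform z a r (conjugateFun lam z m p d) ∈ _
      rw [hs]
      exact Submodule.smul_mem _ _ (quasi_mem_quasiSpan z g a)
    · rintro F ⟨a, rfl⟩
      obtain ⟨r, hr, hrb⟩ := exists_radius hz a
      obtain ⟨s, hs⟩ : ∃ s : ℂ, s = 2 * Real.pi * Complex.I * Complex.exp (-(lam 1 * z a)) :=
        ⟨_, rfl⟩
      have hs0 : s ≠ 0 := by rw [hs]; exact mul_ne_zero hpi (Complex.exp_ne_zero _)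
      have h2 : contourTransform z a r (conjugateFun lam z m p ![1, 0])
          ∈ specialBispectralDual z (quasiSpan lam p) :=
        Submodule.subset_span ⟨_, (mem_conjugateSpace_iff hlam hp hc h).2 ⟨_, rfl⟩, a, r, hr, hrb,
          rfl⟩
      have h3 : (fun u : ℂ => (g a).eval u * Complex.exp (z a * u))
          = s⁻¹ • contourTransform z a r (conjugateFun lam z m p ![1, 0]) := by
        ext u
        rw [Pi.smul_apply, hint a r hr hrb, hgQ]
        simp only [Matrix.cons_val_zero, Matrix.cons_val_one, smul_eq_mul]
        rw [eq_inv_mul_iff_mul_eq₀ hs0, hs]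
        ring
      change (fun u : ℂ => (g a).eval u * Complex.exp (z a * u)) ∈ _
      rw [h3]
      exact Submodule.smul_mem _ _ h2
  have hser : ∀ i k, n i + k ≤ m 0 + m 1 → (PowerSeries.X : PowerSeries ℂ) ^ (k + 1) ∣
      ∑ a, expSeries (z a) * (Q i a : PowerSeries ℂ) := by
    intro i k hk
    rw [Fin.sum_univ_two, hQ, hQ]
    refine X_pow_dvd_expSeries_mul_borelPoly ?_
    have := hBp i 0
    rw [e01] at this
    rw [← this, hdeg]; exact hk
  refine ⟨g, hg0, hgd, hspan, Fin.forall_fin_two.2 ⟨?_, ?_⟩⟩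
  · obtain ⟨a, ha⟩ := h1
    refine ⟨τ, ⟨a, fun h2 => ha (hτ a h2)⟩, ?_⟩
    convert hser 1 (n 0) (by omega) using 2 with a
    rw [hQτ a, Polynomial.coe_mul, Polynomial.coe_C]
    ring
  · refine ⟨fun _ => 1, ⟨0, one_ne_zero⟩, ?_⟩
    convert hser 0 (n 1) hnm.le using 2 with a
    simp [hg, taylor_taylor]

/-- The properties of the special bispectral dual that make it a special space with the roles of
the exponents and of the points interchanged. -/
theorem exists_specialBispectralDual_eq {n : Fin 2 → ℕ} (hlam : lam 0 ≠ lam 1)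
    (hz : Function.Injective z) (hp : ∀ i, p i ≠ 0) (hdeg : ∀ i, (p i).natDegree = n i)
    (hnm : n 0 + n 1 = m 0 + m 1) (hc : c ≠ 0)
    (h : twistedWronskian (lam 0 - lam 1) (p 0) (p 1) = C c * fusionPoly z m)
    (h0 : ∀ a, (p 0).eval (z a) ≠ 0) (h1 : ∃ a, (p 1).eval (z a) ≠ 0) :
    ∃ g : Fin 2 → ℂ[X], (∀ a, g a ≠ 0) ∧ (∀ a, (g a).natDegree = m a) ∧
      specialBispectralDual z (quasiSpan lam p) = quasiSpan z g ∧
      (∃ c', c' ≠ 0 ∧ twistedWronskian (z 0 - z 1) (g 0) (g 1) = C c' * fusionPoly lam n) ∧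
      ∀ i, ∃ a, (g a).eval (lam i) ≠ 0 := by
  obtain ⟨g, hg0, hgd, hspan, hser⟩ :=
    exists_specialBispectralDual_generators hlam hz hp hdeg hnm hc h h0 h1
  have hv : ∀ i, (X - C (lam i)) ^ n i ∣ twistedWronskian (z 0 - z 1) (g 0) (g 1) ∧
      ((∀ a, (g a).eval (lam i) = 0) →
        (X - C (lam i)) ^ (n i + 1) ∣ twistedWronskian (z 0 - z 1) (g 0) (g 1)) := by
    intro i
    obtain ⟨τ, hτ, hdvd⟩ := hser i
    exact X_sub_C_pow_dvd_twistedWronskian hτ hdvd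
  have hz0 : z 0 - z 1 ≠ 0 := sub_ne_zero.2 (hz.ne zero_ne_one)
  have hWd : (twistedWronskian (z 0 - z 1) (g 0) (g 1)).natDegree = n 0 + n 1 := by
    rw [natDegree_twistedWronskian hz0 (hg0 0) (hg0 1), hgd, hgd, hnm]
  have hW0 := twistedWronskian_ne_zero hz0 (hg0 0) (hg0 1)
  have hcop : IsCoprime ((X - C (lam 0)) ^ n 0) ((X - C (lam 1)) ^ n 1) :=
    (isCoprime_X_sub_C_of_isUnit_sub (sub_ne_zero.2 hlam).isUnit).pow
  -- The product of the two powers already has the full degree `n₁ + n₂` of the Wronskian, so the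
  -- cofactor is a constant. A common zero of the `g_a` at `λ_i` would add one factor too many.
  obtain ⟨D, hD⟩ := hcop.mul_dvd (hv 0).1 (hv 1).1
  have hfus : (X - C (lam 0)) ^ n 0 * (X - C (lam 1)) ^ n 1 = fusionPoly lam n :=
    (Fin.prod_univ_two (fun a => (X - C (lam a)) ^ n a)).symm
  rw [hfus] at hD
  have hD0 : D ≠ 0 := by rintro rfl; exact hW0 (by rw [hD, mul_zero])
  have hDd : D.natDegree = 0 := by
    have h2 := hWd
    rw [hD, (fusionPoly_monic lam n).natDegree_mul' hD0, natDegree_fusionPoly] at h2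
    omega
  obtain ⟨c', rfl⟩ := natDegree_eq_zero.1 hDd
  have hc' : c' ≠ 0 := by rintro rfl; exact hD0 C_0
  refine ⟨g, hg0, hgd, hspan, ⟨c', hc', by rw [hD, mul_comm]⟩, fun i => ?_⟩
  by_contra! hcon
  have hdvd := (hv i).2 hcon
  rw [hD, fusionPoly_eq lam n i, pow_succ, mul_assoc,
    mul_dvd_mul_iff_left (pow_ne_zero _ (X_sub_C_ne_zero (lam i))), dvd_iff_isRoot, IsRoot.def] at hdvd
  simp only [eval_mul, eval_pow, eval_sub, eval_X, eval_C] at hdvd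
  refine mul_ne_zero (pow_ne_zero _ (sub_ne_zero.2 ?_)) hc' hdvd
  fin_cases i
  · exact hlam
  · exact hlam.symm

end Dual

/-! ### Critical points and special spaces from the Wronskian equation; generic parameters. -/

lemma exists_fin_roots {y : ℂ[X]} {k : ℕ} (hk : y.natDegree = k)
    (hy : ∀ x, y.eval x = 0 → (derivative y).eval x ≠ 0) :
    ∃ t : Fin k → ℂ, Function.Injective t ∧ y = C y.leadingCoeff * ∏ j, (X - C (t j)) := by
  subst hk
  rcases eq_or_ne y 0 with rfl | hy0
  · exact absurd (by simp) (hy 0 (by simp))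
  have hnd : y.roots.Nodup := by
    rw [Multiset.nodup_iff_count_le_one]
    intro a
    rw [count_roots]
    by_contra! h
    obtain ⟨h1, h2⟩ := (one_lt_rootMultiplicity_iff_isRoot hy0).1 h
    exact hy a h1 h2
  have hprod := (IsAlgClosed.splits y).eq_prod_roots
  have hcard : Multiset.card y.roots = y.natDegree := IsAlgClosed.card_roots_eq_natDegree
  generalize y.roots = s at hnd hprod hcard
  obtain ⟨l, rfl⟩ := Quot.exists_rep s
  change l.Nodup at hnd
  change l.length = _ at hcard
  refine ⟨fun j => l.get (Fin.cast hcard.symm j), ?_, ?_⟩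
  · exact (List.nodup_iff_injective_get.1 hnd).comp (Fin.cast_injective _)
  · have h1 : ∏ j : Fin y.natDegree, (X - C (l.get (Fin.cast hcard.symm j)))
        = (l.map fun a => X - C a).prod := by
      rw [← Fin.prod_univ_fun_getElem]
      exact Fintype.prod_equiv (finCongr hcard.symm) _ _ fun j => rfl
    rw [h1]
    exact hprod

lemma representsAdmissibleCriticalPoint_of_twistedWronskian {k : ℕ} {mu z : Fin 2 → ℂ}
    {m : Fin 2 → ℕ} {p y : ℂ[X]} {c : ℂ} (hz : z 0 ≠ z 1) (hc : c ≠ 0)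
    (h : twistedWronskian (mu 0 - mu 1) p y = C c * fusionPoly z m)
    (hy : ∀ a, y.eval (z a) ≠ 0) (hk : y.natDegree = k) :
    RepresentsAdmissibleCriticalPoint k mu z m y := by
  have hT : ∀ x, y.eval x = 0 → (fusionPoly z m).eval x ≠ 0 := fun x hx =>
    eval_fusionPoly_ne_zero_of_ne fun a ha => hy a (ha ▸ hx)
  obtain ⟨t, ht, hyt⟩ := exists_fin_roots hk fun x hx =>
    (derivative_conditions_of_twistedWronskian_eq hc h hx (hT x hx)).1
  have hl : y.leadingCoeff ≠ 0 := leadingCoeff_ne_zero.2 fun h0 => hy 0 (by simp [h0])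
  have hroot : ∀ j, (∏ j, (X - C (t j))).eval (t j) = 0 := fun j => by
    rw [eval_prod]; exact Finset.prod_eq_zero (Finset.mem_univ j) (by simp)
  have hyroot : ∀ j, y.eval (t j) = 0 := fun j => by rw [hyt, eval_mul, hroot, mul_zero]
  have hA : IsAdmissible mu z m t := (isAdmissible_iff hz).2
    ⟨fun j => eval_fusionPoly_ne_zero.1 (hT _ (hyroot j)), ht⟩
  have h' : twistedWronskian (mu 0 - mu 1) p (∏ j, (X - C (t j)))
      = C (y.leadingCoeff⁻¹ * c) * fusionPoly z m := by
    rw [hyt, twistedWronskian_C_mul_right] at h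
    rw [C_mul, mul_assoc, ← h, ← mul_assoc, ← C_mul, inv_mul_cancel₀ hl, C_1, one_mul]
  refine ⟨⟨t, ⟨_, hl, hyt⟩, hA, (isCriticalPoint_iff hz hA).2 fun j => ?_⟩, hy⟩
  rw [betheExpr_eq_zero_iff ht (hT _ (hyroot j))]
  exact (derivative_conditions_of_twistedWronskian_eq (mul_ne_zero (inv_ne_zero hl) hc) h'
    (hroot j) (hT _ (hyroot j))).2

section Special

variable {lam z : Fin 2 → ℂ} {m : Fin 2 → ℕ} {c : ℂ}

lemma exists_eval_ne_zero_of_twistedWronskian {κ x : ℂ} {p : Fin 2 → ℂ[X]} {T : ℂ[X]}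
    (hT : T.eval x ≠ 0) (h : twistedWronskian κ (p 0) (p 1) = T) : ∃ i, (p i).eval x ≠ 0 := by
  by_contra! hcon
  refine hT ?_
  rw [← h, twistedWronskian]
  simp [hcon]

lemma isSpecialSpace_quasiSpan {n : Fin 2 → ℕ} {p : Fin 2 → ℂ[X]} (hlam : Function.Injective lam)
    (hz : Function.Injective z) (hp : ∀ i, p i ≠ 0) (hdeg : ∀ i, (p i).natDegree = n i)
    (hc : c ≠ 0) (h : twistedWronskian (lam 0 - lam 1) (p 0) (p 1) = C c * fusionPoly z m)
    (hx : ∀ a, ∃ i, (p i).eval (z a) ≠ 0) :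
    IsSpecialSpace lam z n m (quasiSpan lam p) where
  mu_injective := hlam
  z_injective := hz
  exists_basis := ⟨p, fun i => by rw [degree_eq_natDegree (hp i), hdeg], rfl⟩
  exponents_regular := fun x hxz => by
    have hT := eval_fusionPoly_ne_zero_of_ne (m := m) hxz
    have h1 := exponents_quasiSpan (k := 0) hc (by rw [h, pow_zero, one_mul]) hT
      (exists_eval_ne_zero_of_twistedWronskian (by rw [eval_mul, eval_C]; exact mul_ne_zero hc hT) h)
    simpa using h1
  exponents_at := fun a => by
    rw [fusionPoly_eq z m a] at h
    refine exponents_quasiSpan hc h ?_ (hx a)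
    rw [eval_pow, eval_sub, eval_X, eval_C]
    exact pow_ne_zero _ (sub_ne_zero.2 (hz.ne (fin_two_ne_add_one a).symm))

/-- The values of `(λ₁ - λ₂) (z₁ - z₂)` to be excluded for given multiplicities. -/
def nongenericSet (k l : ℕ) : Set ℂ := (finite_setOf_pow_succ_dvd k l).choose

lemma nongenericSet_finite (k l : ℕ) : (nongenericSet k l).Finite :=
  (finite_setOf_pow_succ_dvd k l).choose_spec.1

lemma eval_ne_zero_of_notMem_nongenericSet {κ : ℂ} {p y : ℂ[X]} (hκ : κ ≠ 0)
    (hz : Function.Injective z) (hc : c ≠ 0)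
    (h : twistedWronskian κ p y = C c * fusionPoly z m) (a : Fin 2)
    (hs : κ * (z (a + 1) - z a) ∉ nongenericSet (m a) (m (a + 1)))
    (hx : p.eval (z a) ≠ 0 ∨ y.eval (z a) ≠ 0) : p.eval (z a) ≠ 0 := by
  refine hx.elim id fun hy hp => hs ?_
  rw [fusionPoly_eq z m a] at h
  refine (finite_setOf_pow_succ_dvd _ _).choose_spec.2 κ (z a) (z (a + 1)) c p y hκ
    (hz.ne (fin_two_ne_add_one a).symm) hc h
    (pow_succ_dvd_of_pow_dvd_twistedWronskian (κ := κ) (y := y) ?_ hp hy)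
  rw [h, mul_left_comm]
  exact dvd_mul_right _ _

end Special

lemma exists_mvPolynomial_ne_zero_of_finite {S : Set ℂ} (hS : S.Finite) :
    ∃ P : MvPolynomial (Fin 2 ⊕ Fin 2) ℂ, P ≠ 0 ∧ ∀ lam z : Fin 2 → ℂ,
      MvPolynomial.eval (Sum.elim lam z) P ≠ 0 →
        (lam 0 - lam 1) * (z 0 - z 1) ∉ S ∧ -((lam 0 - lam 1) * (z 0 - z 1)) ∉ S := by
  set D : MvPolynomial (Fin 2 ⊕ Fin 2) ℂ :=
    (MvPolynomial.X (Sum.inl 0) - MvPolynomial.X (Sum.inl 1)) *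
      (MvPolynomial.X (Sum.inr 0) - MvPolynomial.X (Sum.inr 1)) with hD
  have hne : ∀ s : ℂ, D - MvPolynomial.C s ≠ 0 := fun s h => by
    have := congrArg (MvPolynomial.eval (Sum.elim ![s + 1, 0] ![1, 0])) h
    simp [hD] at this
  -- Both signs are needed since `κ (z_b - z_a)` changes sign with the order of the points.
  refine ⟨∏ s ∈ hS.toFinset, (D - MvPolynomial.C s) * (D - MvPolynomial.C (-s)),
    Finset.prod_ne_zero_iff.2 fun s _ => mul_ne_zero (hne s) (hne (-s)), fun lam z h => ?_⟩
  rw [map_prod, Finset.prod_ne_zero_iff] at h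
  have key : ∀ s ∈ S, (lam 0 - lam 1) * (z 0 - z 1) - s ≠ 0 ∧
      (lam 0 - lam 1) * (z 0 - z 1) + s ≠ 0 := fun s hs => by
    have := h s (hS.mem_toFinset.2 hs)
    simpa [hD] using this
  exact ⟨fun hs => (key _ hs).1 (sub_self _), fun hs => (key _ hs).2 (by ring)⟩

/-! ### The space associated with a critical point. -/

section Associated

variable {lam z : Fin 2 → ℂ} {n m : Fin 2 → ℕ} {t : Fin (n 1) → ℂ}

lemma eval_prod_X_sub_C_ne_zero_of_admissible (h : ∀ j a, m a ≠ 0 → t j ≠ z a) {a : Fin 2}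
    (ha : m a ≠ 0) : (∏ j, (X - C (t j))).eval (z a) ≠ 0 :=
  eval_prod_X_sub_C_ne_zero fun j => (h j a ha).symm

/-- Admissibility keeps the roots of `y` off `z_a` only if `m_a ≠ 0`; if `m_a = 0`, the Wronskian
itself is nonzero at `z_a`. -/
lemma exists_eval_ne_zero_of_admissible {κ c : ℂ} {p : Fin 2 → ℂ[X]} (hz : Function.Injective z)
    (hc : c ≠ 0) (h : ∀ j a, m a ≠ 0 → t j ≠ z a)
    (hW : twistedWronskian κ (p 0) (p 1) = C c * fusionPoly z m)
    {b : ℂ} (hb : b ≠ 0) (hp1 : p 1 = C b * ∏ j, (X - C (t j))) (a : Fin 2) :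
    ∃ i, (p i).eval (z a) ≠ 0 := by
  by_cases ha : m a = 0
  · refine exists_eval_ne_zero_of_twistedWronskian ?_ hW
    rw [eval_mul, eval_C]
    refine mul_ne_zero hc (eval_fusionPoly_ne_zero.2 fun b hb hab => ?_)
    exact hb (hz hab ▸ ha)
  · refine ⟨1, ?_⟩
    rw [hp1, eval_mul, eval_C]
    exact mul_ne_zero hb (eval_prod_X_sub_C_ne_zero_of_admissible h ha)

theorem exists_isAssociatedSpace (hnm : n 0 + n 1 = m 0 + m 1) (hlam : Function.Injective lam)
    (hz : Function.Injective z) (hA : IsAdmissible lam z m t) (hC : IsCriticalPoint lam z m t) :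
    ∃ V : Submodule ℂ (ℂ → ℂ), IsAssociatedSpace lam z n m t V := by
  have hz01 : z 0 ≠ z 1 := hz.ne zero_ne_one
  have hκ : lam 0 - lam 1 ≠ 0 := sub_ne_zero.2 (hlam.ne zero_ne_one)
  obtain ⟨ht, htinj⟩ := (isAdmissible_iff hz01).1 hA
  have hB := (isCriticalPoint_iff hz01 hA).1 hC
  obtain ⟨p₀, hp₀⟩ := exists_twistedWronskian_eq hκ htinj (fusionPoly z m) fun j =>
    (betheExpr_eq_zero_iff htinj (eval_fusionPoly_ne_zero.2 (ht j))).1 (hB j)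
  set y : ℂ[X] := ∏ j, (X - C (t j)) with hy
  have hym : y.Monic := monic_prod_of_monic _ _ fun j _ => monic_X_sub_C (t j)
  have hyd : y.natDegree = n 1 := by
    rw [hy, natDegree_prod_of_monic _ _ fun j _ => monic_X_sub_C (t j)]; simp
  have hp₀0 : p₀ ≠ 0 := by
    rintro rfl
    exact fusionPoly_ne_zero z m (hp₀.symm.trans (by simp [twistedWronskian]))
  have hp₀d : p₀.natDegree = n 0 := by
    have := natDegree_twistedWronskian hκ hp₀0 hym.ne_zero
    rw [hp₀, natDegree_fusionPoly, hyd] at this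
    omega
  have hW : twistedWronskian (lam 0 - lam 1) (![p₀, y] 0) (![p₀, y] 1) = C 1 * fusionPoly z m := by
    rw [C_1, one_mul]; exact hp₀
  refine ⟨quasiSpan lam ![p₀, y], isSpecialSpace_quasiSpan hlam hz ?_ ?_ one_ne_zero hW
    (exists_eval_ne_zero_of_admissible hz one_ne_zero ht hW one_ne_zero (by simp [hy])), ?_⟩
  · exact Fin.forall_fin_two.2 ⟨hp₀0, hym.ne_zero⟩
  · exact Fin.forall_fin_two.2 ⟨hp₀d, hyd⟩
  · intro f hf x hxz hxt
    obtain ⟨d, rfl⟩ := mem_quasiSpan_iff.1 hf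
    rw [criticalPointOp_sum_quasi lam d _ hxz hxt, ← hy, Fin.sum_univ_two]
    -- The inner factor sends the first generator to `T e^(λ₁x) / y`, which the outer one kills; the
    -- second generator `y e^(λ₂x)` is killed by the inner factor.
    have h1 : twistedWronskian (lam 0 - lam 0) (twistedWronskian (lam 0 - lam 1)
        ((![p₀, y] : Fin 2 → ℂ[X]) 0) y) (fusionPoly z m) = 0 := by
      change twistedWronskian _ (twistedWronskian _ p₀ y) _ = 0
      rw [hp₀, sub_self, twistedWronskian, C_0]; ring
    have h2 : twistedWronskian (lam 1 - lam 0) (twistedWronskian (lam 1 - lam 1)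
        ((![p₀, y] : Fin 2 → ℂ[X]) 1) y) (fusionPoly z m) = 0 := by
      have : twistedWronskian (lam 1 - lam 1) y y = 0 := by
        rw [sub_self, twistedWronskian, C_0]; ring
      change twistedWronskian _ (twistedWronskian _ y y) _ = 0
      rw [this]; simp [twistedWronskian]
    rw [h1, h2]; simp

/-- For `p₂` the outer twist is nonzero, so the inner Wronskian must vanish and `p₂` is proportional
to `y`. For `p₁` the outer twist is zero, so the inner Wronskian is proportional to `T`. -/
lemma exists_basis_of_isAssociatedSpace {V : Submodule ℂ (ℂ → ℂ)}
    (hV : IsAssociatedSpace lam z n m t V) :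
    ∃ p : Fin 2 → ℂ[X], (∀ i, p i ≠ 0) ∧ (∀ i, (p i).natDegree = n i) ∧ V = quasiSpan lam p ∧
      (∃ c, c ≠ 0 ∧ twistedWronskian (lam 0 - lam 1) (p 0) (p 1) = C c * fusionPoly z m) ∧
      ∃ b, b ≠ 0 ∧ p 1 = C b * ∏ j, (X - C (t j)) := by
  obtain ⟨p, hpd, rfl⟩ := hV.special.exists_basis
  have hp : ∀ i, p i ≠ 0 := fun i h => by
    have := hpd i; rw [h, degree_zero] at this; exact WithBot.bot_ne_coe this
  have hκ : lam 0 - lam 1 ≠ 0 := sub_ne_zero.2 (hV.special.mu_injective.ne zero_ne_one)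
  have hW := twistedWronskian_eq_zero_of_criticalPointOp lam p hV.annihilates
  set y : ℂ[X] := ∏ j, (X - C (t j)) with hy
  have hy0 : y ≠ 0 := (monic_prod_of_monic _ _ fun j _ => monic_X_sub_C (t j)).ne_zero
  have hT := fusionPoly_ne_zero z m
  have h1 : twistedWronskian (lam 1 - lam 1) (p 1) y = 0 :=
    eq_zero_of_twistedWronskian_eq_zero (by rw [← neg_sub]; exact neg_ne_zero.2 hκ) hT (hW 1)
  obtain ⟨b, hb⟩ := exists_eq_C_mul_of_wronskian_eq_zero (w := p 1) hy0 (by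
    rw [sub_self, twistedWronskian, C_0] at h1; linear_combination h1)
  have hb0 : b ≠ 0 := by rintro rfl; exact hp 1 (by rw [hb, C_0, zero_mul])
  obtain ⟨c, hc⟩ := exists_eq_C_mul_of_wronskian_eq_zero
    (w := twistedWronskian (lam 0 - lam 1) (p 0) y) hT (by
      have := hW 0
      rw [sub_self, twistedWronskian, C_0] at this; linear_combination this)
  have hc0 : c ≠ 0 := by
    rintro rfl
    exact twistedWronskian_ne_zero hκ (hp 0) hy0 (by rw [hc, C_0, zero_mul])
  refine ⟨p, hp, fun i => natDegree_eq_of_degree_eq_some (hpd i), rfl,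
    ⟨b * c, mul_ne_zero hb0 hc0, ?_⟩, b, hb0, hb⟩
  rw [hb, twistedWronskian_C_mul_right, hc, C_mul, mul_assoc]

end Associated

end GaudinDuality

end

/-! ### Assembly of the duality. -/

theorem mainTheorem6 (n m : Fin 2 → ℕ) (hnm : n 0 + n 1 = m 0 + m 1) :
    -- generic parameters: off the zero set of a nonzero polynomial depending only on n and m
    ∃ P : MvPolynomial (Fin 2 ⊕ Fin 2) ℂ, P ≠ 0 ∧
      ∀ lam z : Fin 2 → ℂ, MvPolynomial.eval (Sum.elim lam z) P ≠ 0 →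
      ∀ t : Fin (n 1) → ℂ,
        GaudinDuality.IsAdmissible lam z m t → GaudinDuality.IsCriticalPoint lam z m t →
        (∃ V : Submodule ℂ (ℂ → ℂ), GaudinDuality.IsAssociatedSpace lam z n m t V) ∧
        ∀ V : Submodule ℂ (ℂ → ℂ), GaudinDuality.IsAssociatedSpace lam z n m t V →
          (∃ q : Fin 2 → Polynomial ℂ,
            GaudinDuality.specialBispectralDual z V = GaudinDuality.quasiSpan z q) ∧
          ∀ p q : Fin 2 → Polynomial ℂ,
            V = GaudinDuality.quasiSpan lam p →
            GaudinDuality.specialBispectralDual z V = GaudinDuality.quasiSpan z q →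
            GaudinDuality.RepresentsAdmissibleCriticalPoint (n 0) ![lam 1, lam 0] z m (p 0) ∧
            GaudinDuality.RepresentsAdmissibleCriticalPoint (m 1) z lam n (q 1) := by
  open GaudinDuality in
  -- The value `0` forces distinct exponents and distinct points; the sets for `m` concern `p₁` at
  -- the `z_a`, and those for `n` concern `q₂` at the `λ_i`.
  set S : Set ℂ := {0} ∪ ((nongenericSet (m 0) (m 1) ∪ nongenericSet (m 1) (m 0)) ∪
    (nongenericSet (n 0) (n 1) ∪ nongenericSet (n 1) (n 0))) with hS
  have hSfin : S.Finite := (Set.finite_singleton 0).union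
    (((nongenericSet_finite _ _).union (nongenericSet_finite _ _)).union
      ((nongenericSet_finite _ _).union (nongenericSet_finite _ _)))
  obtain ⟨P, hP0, hP⟩ := exists_mvPolynomial_ne_zero_of_finite hSfin
  refine ⟨P, hP0, fun lam z hlz t hA hC => ?_⟩
  obtain ⟨hs, hs'⟩ := hP lam z hlz
  simp only [hS, Set.mem_union, Set.mem_singleton_iff, not_or] at hs hs'
  obtain ⟨hs0, ⟨-, hsm⟩, hsn, -⟩ := hs
  obtain ⟨-, ⟨hsm', -⟩, -, hsn'⟩ := hs'
  have hlam01 : lam 0 - lam 1 ≠ 0 := left_ne_zero_of_mul hs0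
  have hz01 : z 0 - z 1 ≠ 0 := right_ne_zero_of_mul hs0
  have hinj : ∀ f : Fin 2 → ℂ, f 0 - f 1 ≠ 0 → Function.Injective f := by
    intro f hf i j hij
    have hf' : f 0 ≠ f 1 := sub_ne_zero.1 hf
    fin_cases i <;> fin_cases j <;>
      first | rfl | exact absurd hij hf' | exact absurd hij.symm hf'
  have hlam := hinj lam hlam01
  have hz := hinj z hz01
  refine ⟨exists_isAssociatedSpace hnm hlam hz hA hC, fun V hV => ?_⟩
  obtain ⟨ht, -⟩ := (isAdmissible_iff (sub_ne_zero.1 hz01)).1 hA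
  obtain ⟨p, hp, hpd, rfl, ⟨c, hc, hW⟩, b, hb, hpb⟩ :=
    exists_basis_of_isAssociatedSpace hV
  have hx := exists_eval_ne_zero_of_admissible hz hc ht hW hb hpb
  have h0 : ∀ a, (p 0).eval (z a) ≠ 0 := by
    intro a
    refine eval_ne_zero_of_notMem_nongenericSet hlam01 hz hc hW a ?_ ?_
    · revert a
      refine Fin.forall_fin_two.2 ⟨?_, hsm⟩
      have e : (lam 0 - lam 1) * (z (0 + 1) - z 0) = -((lam 0 - lam 1) * (z 0 - z 1)) := by
        rw [zero_add]; ring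
      rw [e]; exact hsm'
    · exact Fin.exists_fin_two.1 (hx a)
  -- Vanishing at both points would force `m = 0`, hence `n₂ = 0`, and `p₂` is then a nonzero
  -- constant.
  have h1 : ∃ a, (p 1).eval (z a) ≠ 0 := by
    by_contra! hcon
    have hm : ∀ a, m a = 0 := by
      intro a
      by_contra ha
      have h2 := hcon a
      rw [hpb, eval_mul, eval_C] at h2
      exact mul_ne_zero hb (eval_prod_X_sub_C_ne_zero_of_admissible ht ha) h2
    have hn : (p 1).natDegree = 0 := by
      rw [hpd]; have := hm 0; have := hm 1; omega
    obtain ⟨s, hs⟩ := natDegree_eq_zero.1 hn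
    have h2 := hcon 0
    rw [← hs, eval_C] at h2
    exact hp 1 (by rw [← hs, h2, C_0])
  obtain ⟨g, hg0, hgd, hdual, ⟨c', hc', hWg⟩, hgx⟩ := exists_specialBispectralDual_eq
    (sub_ne_zero.1 hlam01) hz hp hpd hnm hc hW h0 h1
  refine ⟨⟨g, hdual⟩, fun p' q hp' hq => ⟨?_, ?_⟩⟩
  · obtain ⟨s, hs, hps⟩ := exists_eq_C_mul_of_quasiSpan_eq (sub_ne_zero.1 hlam01) hp hp'.symm 0
    refine representsAdmissibleCriticalPoint_of_twistedWronskian (p := p 1) (c := s * -c)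
      (sub_ne_zero.1 hz01) (mul_ne_zero hs (neg_ne_zero.2 hc)) ?_ (fun a => ?_) ?_
    · change twistedWronskian (lam 1 - lam 0) _ _ = _
      rw [hps, twistedWronskian_C_mul_right, ← neg_sub, twistedWronskian_swap, hW, C_mul, C_neg]
      ring
    · rw [hps, eval_mul, eval_C]; exact mul_ne_zero hs (h0 a)
    · rw [hps, natDegree_C_mul hs, hpd]
  · obtain ⟨s, hs, hqs⟩ := exists_eq_C_mul_of_quasiSpan_eq (sub_ne_zero.1 hz01) hg0
      (hq.symm.trans hdual) 1
    refine representsAdmissibleCriticalPoint_of_twistedWronskian (p := g 0) (c := s * c')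
      (sub_ne_zero.1 hlam01) (mul_ne_zero hs hc') ?_ (fun i => ?_) ?_
    · rw [hqs, twistedWronskian_C_mul_right, hWg, C_mul, mul_assoc]
    · rw [hqs, eval_mul, eval_C]
      refine mul_ne_zero hs ?_
      have hWg' : twistedWronskian (z 1 - z 0) (g 1) (g 0) = C (-c') * fusionPoly lam n := by
        rw [← neg_sub, twistedWronskian_swap, hWg, C_neg, neg_mul]
      refine eval_ne_zero_of_notMem_nongenericSet
        (by rw [← neg_sub]; exact neg_ne_zero.2 hz01) hlam (neg_ne_zero.2 hc') hWg' i ?_ ?_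
      · revert i
        refine Fin.forall_fin_two.2 ⟨?_, ?_⟩
        · have e : (z 1 - z 0) * (lam (0 + 1) - lam 0) = (lam 0 - lam 1) * (z 0 - z 1) := by
            rw [zero_add]; ring
          rw [e]; exact hsn
        · have e : (z 1 - z 0) * (lam (1 + 1) - lam 1) = -((lam 0 - lam 1) * (z 0 - z 1)) := by
            rw [show (1 + 1 : Fin 2) = 0 from rfl]; ring
          rw [e]; exact hsn'
      · exact (Fin.exists_fin_two.1 (hgx i)).symm
    · rw [hqs, natDegree_C_mul hs, hgd]
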